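/- Let $\gamma>0$, $a\in(0,1)$, $b=1-a$, $\Upsilon=\max(\gamma,2)$ and $\langle x\rangle=(1+|x|^2)^{1/2}$. For $k\ge 0$ let $\mathcal P^0_k(\mathbb R)$ be the set of Borel probability measures $\mu$ on $\mathbb R$ with $\int|x|^k\mu(dx)<\infty$, $\int |x|\,\mu(dx)<\infty$ and $\int x\,\mu(dx)=0$. For nonnegative Borel measures put $\|\mu\|_\Upsilon=\int\langle x\rangle^\Upsilon\mu(dx)$ and, if $\|\mu\|_\Upsilon<\infty$ and $\varphi\in\mathcal C_b(\mathbb R)$ (bounded and continuous), $$\langle\mathcal Q(\mu,\mu);\varphi\rangle=\frac12\int_{\mathbb R^2}|x-y|^\gamma\big(\varphi(ax+by)+\varphi(bx+ay)-\varphi(x)-\varphi(y)\big)\,\mu(dx)\,\mu(dy).$$ Given $\mu_0$ with $\|\mu_0\|_\Upsilon<\infty$, a *measure weak solution* (of the one-dimensional dissipative Boltzmann equation $\partial_t\mu_t=\mathcal Q(\mu_t,\mu_t)$) associated to $\mu_0$ is a family $(\mu_t)_{t\ge0}$ of nonnegative Borel measures such that (1) $\|\mu_t\|_\Upsilon\le\|\mu_0\|_\Upsilon$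 for all $t\ge 0$, and $\int\mu_t(dx)=\int\mu_0(dx)$, $\int x\,\mu_t(dx)=\int x\,\mu_0(dx)$ for all $t>0$; (2) for every $\varphi\in\mathcal C_b(\mathbb R)$ the map $t\mapsto\langle\mathcal Q(\mu_t,\mu_t);\varphi\rangle$ is continuous and locally integrable on $[0,\infty)$, and $$\int\varphi\,d\mu_t=\int\varphi\,d\mu_0+\int_0^t\langle\mathcal Q(\mu_\tau,\mu_\tau);\varphi\rangle\,d\tau\qquad\text{for all }t\ge0.$$ **Theorem.** Let $\mu_0\in\mathcal P^0_\Upsilon(\mathbb R)$. There exists a measure weak solution $(\mu_t)_{t\ge0}$ associated to $\mu_0$ with the following properties. 1. For all $t\ge 0$, $\mu_t\in\mathcal P^0_\Upsilon(\mathbb R)$, that is, $\int\mu_t(dx)=\int\mu_0(dx)=1$, $\int x\,\mu_t(dx)=\int x\,\mu_0(dx)=0$ and $\int|x|^\Upsilon\mu_t(dx)<\infty$; moreover $\int|x|^\Upsilon\mu_t(dx)\le\int|x|^\Upsilon\mu_0(dx)$ for all $t\ge 0$, and $t\mapsto\int|x|^\Upsilon\mu_t(dx)$ is non-increasing on $[0,\infty)$.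 2. If $\mu_0\in\bigcap_{k\ge0}\mathcal P^0_k(\mathbb R)$, then $\mu_t\in\bigcap_{k\ge0}\mathcal P^0_k(\mathbb R)$ for all $t\ge0$. 3. If there is $\varepsilon>0$ with $\int\exp(\varepsilon|x|^\gamma)\,\mu_0(dx)<\infty$, then such a solution is unique: every measure weak solution $(\nu_t)_{t\ge0}$ associated to $\mu_0$ with $\int|x|^{1+\gamma}\nu_t(dx)<\infty$ for all $t>0$ satisfies $\nu_t=\mu_t$ for all $t\ge0$. (For $\gamma\le1$ the moment condition holds for every measure weak solution; for every $\gamma$ it holds for every measure weak solution contained in $\bigcap_{k\ge0}\mathcal P^0_k(\mathbb R)$, in particular for $(\mu_t)_{t\ge0}$.) 4. If $\mu_0$ is absolutely continuous with respect to Lebesgue measure, then so is $\mu_t$ for every $t\ge0$: there are nonnegative $f_t\in L^1(\mathbb R)$ with $\int\langle x\rangle^\Upsilon f_t(x)\,dx<\infty$ and $\mu_t(dx)=f_t(x)\,dx$. -/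

import Mathlib

open MeasureTheory Set
open scoped BoundedContinuousFunction

noncomputable section

namespace DissipativeBoltzmann

/-- The Japanese bracket `⟨x⟩ = (1 + |x|²)^{1/2}`. -/
def bracket (x : ℝ) : ℝ := Real.sqrt (1 + |x| ^ 2)

/-- The cone of nonnegative Borel measures on `ℝ` with `∫ ⟨x⟩ˢ dμ < ∞`. -/
def MPlus (s : ℝ) : Set (Measure ℝ) :=
  {μ | Integrable (fun x => bracket x ^ s) μ}

/-- The norm `‖μ‖ₛ = ∫ ⟨x⟩ˢ dμ` of a nonnegative measure. -/
def wnorm (s : ℝ) (μ : Measure ℝ) : ℝ := ∫ x, bracket x ^ s ∂μ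

/-- The absolute moment `M_k(μ) = ∫ |x|ᵏ dμ`. -/
def moment (k : ℝ) (μ : Measure ℝ) : ℝ := ∫ x, |x| ^ k ∂μ

/-- Centred Borel probability measures on `ℝ` with finite absolute moment of order `k`.
(For `k ≥ 1` integrability of `x` is automatic.) -/
def PZero (k : ℝ) : Set (Measure ℝ) :=
  {μ | IsProbabilityMeasure μ ∧ Integrable (fun x : ℝ => |x| ^ k) μ ∧
    Integrable (fun x : ℝ => x) μ ∧ ∫ x, x ∂μ = 0}

/-- The weighted space `L¹ₛ` of Lebesgue-integrable functions with `∫ ⟨x⟩ˢ |f(x)| dx < ∞`. -/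
def MemL1 (s : ℝ) (f : ℝ → ℝ) : Prop :=
  Integrable f volume ∧ Integrable (fun x => bracket x ^ s * |f x|) volume

/-- `Δφ(x,y) = φ(ax+by) + φ(bx+ay) - φ(x) - φ(y)` with `b = 1 - a`. -/
def collisionDelta (a : ℝ) (φ : ℝ → ℝ) (x y : ℝ) : ℝ :=
  φ (a * x + (1 - a) * y) + φ ((1 - a) * x + a * y) - φ x - φ y

/-- The collision operator in weak form,
`⟨Q(μ,ν); φ⟩ = 1/2 ∫∫ |x-y|^γ Δφ(x,y) μ(dx) ν(dy)`. -/
def collisionQ (a γ : ℝ) (μ ν : Measure ℝ) (φ : ℝ → ℝ) : ℝ :=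
  (1 / 2) * ∫ p : ℝ × ℝ, |p.1 - p.2| ^ γ * collisionDelta a φ p.1 p.2 ∂(μ.prod ν)

/-- Measure weak solutions `(μ t)`, `t ≥ 0`, of `∂ₜ μ = Q(μ, μ)` with initial datum `μ₀`.
Values of `μ` at negative times are irrelevant. -/
structure IsMeasureWeakSolution (a γ : ℝ) (μ₀ : Measure ℝ) (μ : ℝ → Measure ℝ) : Prop where
  initial_mem : μ₀ ∈ MPlus (max γ 2)
  mem : ∀ t, 0 ≤ t → μ t ∈ MPlus (max γ 2)
  norm_le : ∀ t, 0 ≤ t → wnorm (max γ 2) (μ t) ≤ wnorm (max γ 2) μ₀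
  mass : ∀ t, 0 < t → μ t univ = μ₀ univ
  momentum : ∀ t, 0 < t → ∫ x, x ∂(μ t) = ∫ x, x ∂μ₀
  continuousOn : ∀ φ : ℝ →ᵇ ℝ,
    ContinuousOn (fun t => collisionQ a γ (μ t) (μ t) φ) (Ici 0)
  locallyIntegrableOn : ∀ φ : ℝ →ᵇ ℝ,
    LocallyIntegrableOn (fun t => collisionQ a γ (μ t) (μ t) φ) (Ici 0)
  weak_eq : ∀ φ : ℝ →ᵇ ℝ, ∀ t, 0 ≤ t →
    ∫ x, φ x ∂(μ t) = ∫ x, φ x ∂μ₀ + ∫ τ in (0 : ℝ)..t, collisionQ a γ (μ τ) (μ τ) φ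

end DissipativeBoltzmann

end

/-!
Collisions replace a pair of velocities `x, y` by the convex combinations `a x + (1 - a) y` and
`(1 - a) x + a y`. Every convex functional of the velocity distribution is therefore non-increasing,
so the whole evolution stays below the initial datum in the convex order `ConvexLE`. Applied to
`(|x - y|ˢ - R)₊` in each variable, this yields uniform integrability of the unbounded kernel
`|x - y|^γ`, with tails controlled by the initial datum alone (`ConvexLE.excessInt_le`).

*Existence.* The kernel is truncated at level `n + 1` and time is discretised explicitly with a step
so small that one step (`step`) maps probability measures to probability measures and decreases in
the convex order. First moments give tightness, and Prokhorov's theorem gives a limit along an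
ultrafilter at every time. The time increments of the scheme have a first order expansion whose
remainder is uniform in `n`; it survives in the limit (`IsCollisionFlow.expansion`), shows that
`t ↦ ∫ φ dμₜ` has the continuous right derivative `⟨Q(μₜ, μₜ); φ⟩`, and hence gives the weak
equation. The critical moment passes to the limit by uniform integrability, and the mean is preserved
because measures comparable in the convex order have equal means.

*Absolute continuity.* Let `A` be a null set carrying the singular parts of all `μₜ`. A collision in
which one partner has a velocity outside `A` almost surely ends outside `A`, so the mass gained by
`A` never exceeds the mass lost (`map_post_collisionPairs_le`). Extending the expansion from
continuous functions to `A` by regularity shows that `μₜ(A)` does not increase.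

*Uniqueness.* For an arbitrary weak solution `ν` with finite moments of order `1 + γ`, the functions
`(|x| - r)₊` may be used as test functions on time intervals on which that moment is bounded, and
their integrals decrease there. A Baire category argument (`antitone_of_locally_bounded`) removes
the boundedness assumption. Since powers `|x|^p`, `p ≥ 1`, are superpositions of these functions,
all moments of `ν` are below those of `μ₀`, and by the exponential series `ν` inherits an
exponential moment. Finally, truncating the kernel at level `R` makes `Q` Lipschitz in total
variation with constant `O(R)` up to an error `O(exp (-c R))`; Gronwall's argument
and `R → ∞` give uniqueness on a time interval proportional to `c`, and then for all times
(`IsMeasureWeakSolution.eq_of_exp_moment`).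
-/

namespace DissipativeBoltzmann

open Filter Topology ENNReal

/-! ### Convex order -/

/-- `ConvexLE μ ν`: the measure `μ` is dominated by `ν` in the convex order, tested on nonnegative
continuous convex functions so that all integrals make sense in `[0, ∞]`. -/
def ConvexLE (μ ν : Measure ℝ) : Prop :=
  ∀ φ : ℝ → ℝ, ConvexOn ℝ univ φ → (∀ x, 0 ≤ φ x) → Continuous φ →
    ∫⁻ x, ENNReal.ofReal (φ x) ∂μ ≤ ∫⁻ x, ENNReal.ofReal (φ x) ∂ν

lemma ConvexLE.refl (μ : Measure ℝ) : ConvexLE μ μ := fun _ _ _ _ => le_rfl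

lemma ConvexLE.trans {μ ν ρ : Measure ℝ} (h₁ : ConvexLE μ ν) (h₂ : ConvexLE ν ρ) :
    ConvexLE μ ρ := fun φ hφ h0 hc => (h₁ φ hφ h0 hc).trans (h₂ φ hφ h0 hc)

lemma ConvexLE.integrable {μ ν : Measure ℝ} (h : ConvexLE μ ν) {φ : ℝ → ℝ}
    (hφ : ConvexOn ℝ univ φ) (h0 : ∀ x, 0 ≤ φ x) (hc : Continuous φ) (hi : Integrable φ ν) :
    Integrable φ μ := by
  refine ⟨hc.aestronglyMeasurable, ?_⟩
  rw [hasFiniteIntegral_iff_ofReal (Eventually.of_forall h0)]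
  refine (h φ hφ h0 hc).trans_lt ?_
  exact (hasFiniteIntegral_iff_ofReal (Eventually.of_forall h0)).1 hi.2

lemma ConvexLE.integral_le {μ ν : Measure ℝ} (h : ConvexLE μ ν) {φ : ℝ → ℝ}
    (hφ : ConvexOn ℝ univ φ) (h0 : ∀ x, 0 ≤ φ x) (hc : Continuous φ) (hi : Integrable φ ν) :
    ∫ x, φ x ∂μ ≤ ∫ x, φ x ∂ν := by
  have hi' := h.integrable hφ h0 hc hi
  rw [← ENNReal.ofReal_le_ofReal_iff (integral_nonneg h0),
    ofReal_integral_eq_lintegral_ofReal hi' (Eventually.of_forall h0),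
    ofReal_integral_eq_lintegral_ofReal hi (Eventually.of_forall h0)]
  exact h φ hφ h0 hc

lemma convexOn_rpow_of_nonneg {f : ℝ → ℝ} (hf : ConvexOn ℝ univ f) (h0 : ∀ x, 0 ≤ f x)
    {s : ℝ} (hs : 1 ≤ s) : ConvexOn ℝ univ (fun x => f x ^ s) := by
  refine ⟨convex_univ, fun x _ y _ a b ha hb hab => ?_⟩
  calc f (a • x + b • y) ^ s ≤ (a • f x + b • f y) ^ s :=
        Real.rpow_le_rpow (h0 _) (hf.2 (mem_univ _) (mem_univ _) ha hb hab) (by linarith)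
    _ ≤ a • f x ^ s + b • f y ^ s := (convexOn_rpow hs).2 (h0 x) (h0 y) ha hb hab

lemma convexOn_abs_sub (y : ℝ) : ConvexOn ℝ univ (fun x : ℝ => |x - y|) := by
  simpa [Real.dist_eq] using convexOn_univ_dist (E := ℝ) y

lemma convexOn_abs_univ : ConvexOn ℝ univ (fun x : ℝ => |x|) := by
  simpa using convexOn_abs_sub 0

lemma convexOn_abs_rpow {s : ℝ} (hs : 1 ≤ s) : ConvexOn ℝ univ (fun x : ℝ => |x| ^ s) :=
  convexOn_rpow_of_nonneg convexOn_abs_univ (fun x => abs_nonneg x) hs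

lemma continuous_abs_rpow {s : ℝ} (hs : 0 ≤ s) : Continuous (fun x : ℝ => |x| ^ s) :=
  continuous_abs.rpow_const fun _ => Or.inr hs

lemma continuous_bracket : Continuous bracket := by
  unfold bracket; fun_prop

lemma one_le_bracket (x : ℝ) : 1 ≤ bracket x := by
  unfold bracket
  rw [Real.one_le_sqrt]
  nlinarith [sq_nonneg |x|]

lemma abs_le_bracket (x : ℝ) : |x| ≤ bracket x := by
  unfold bracket
  exact Real.le_sqrt_of_sq_le (by linarith)

lemma bracket_le (x : ℝ) : bracket x ≤ 1 + |x| := by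
  unfold bracket
  rw [Real.sqrt_le_left (by positivity)]
  nlinarith [abs_nonneg x]

lemma convexOn_bracket : ConvexOn ℝ univ bracket := by
  have key : ∀ x : ℝ, bracket x = ‖(x : ℂ) + (1 : ℝ) * Complex.I‖ := by
    intro x
    rw [Complex.norm_add_mul_I, bracket, sq_abs]
    congr 1; ring
  refine ⟨convex_univ, fun x _ y _ a b ha hb hab => ?_⟩
  simp only [key, smul_eq_mul]
  have e : ((a * x + b * y : ℝ) : ℂ) + (1 : ℝ) * Complex.I =
      (a : ℂ) * ((x : ℂ) + (1 : ℝ) * Complex.I) + (b : ℂ) * ((y : ℂ) + (1 : ℝ) * Complex.I) := by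
    have : (a : ℂ) + b = 1 := by exact_mod_cast hab
    push_cast
    linear_combination (-Complex.I) * this
  rw [e]
  refine (norm_add_le _ _).trans (le_of_eq ?_)
  rw [norm_mul, norm_mul, Complex.norm_of_nonneg ha, Complex.norm_of_nonneg hb]

lemma rpow_add_le {x y s : ℝ} (hx : 0 ≤ x) (hy : 0 ≤ y) (hs : 0 ≤ s) :
    (x + y) ^ s ≤ 2 ^ s * (x ^ s + y ^ s) := by
  have h1 : x + y ≤ 2 * max x y := by
    linarith [le_max_left x y, le_max_right x y]
  calc (x + y) ^ s ≤ (2 * max x y) ^ s := Real.rpow_le_rpow (by positivity) h1 hs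
    _ = 2 ^ s * (max x y) ^ s := Real.mul_rpow (by norm_num) (le_max_of_le_left hx)
    _ ≤ 2 ^ s * (x ^ s + y ^ s) := by
        gcongr
        have := Real.rpow_nonneg hx s
        have := Real.rpow_nonneg hy s
        rcases max_choice x y with h | h <;> rw [h] <;> linarith

lemma abs_sub_rpow_le (x y : ℝ) {s : ℝ} (hs : 0 ≤ s) :
    |x - y| ^ s ≤ 2 ^ s * (|x| ^ s + |y| ^ s) :=
  (Real.rpow_le_rpow (abs_nonneg _) (abs_sub x y) hs).trans
    (rpow_add_le (abs_nonneg _) (abs_nonneg _) hs)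

lemma rpow_le_one_add_rpow {u r s : ℝ} (hu : 0 ≤ u) (hr : 0 ≤ r) (hrs : r ≤ s) :
    u ^ r ≤ 1 + u ^ s := by
  rcases le_total u 1 with h | h
  · linarith [Real.rpow_le_one hu h hr, Real.rpow_nonneg hu s]
  · linarith [Real.rpow_le_rpow_of_exponent_le h hrs]

lemma integrable_abs_rpow_of_le {μ : Measure ℝ} [IsFiniteMeasure μ] {r s : ℝ} (hr : 0 ≤ r)
    (hrs : r ≤ s) (h : Integrable (fun x : ℝ => |x| ^ s) μ) :
    Integrable (fun x : ℝ => |x| ^ r) μ := by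
  refine ((integrable_const (1 : ℝ)).add h).mono'
    (continuous_abs_rpow hr).aestronglyMeasurable (Eventually.of_forall fun x => ?_)
  rw [Real.norm_of_nonneg (Real.rpow_nonneg (abs_nonneg x) r)]
  exact rpow_le_one_add_rpow (abs_nonneg x) hr hrs

lemma integrable_id_of_rpow {μ : Measure ℝ} [IsFiniteMeasure μ] {s : ℝ} (hs : 1 ≤ s)
    (h : Integrable (fun x : ℝ => |x| ^ s) μ) : Integrable (fun x : ℝ => x) μ := by
  have h1 := integrable_abs_rpow_of_le zero_le_one hs h
  simp only [Real.rpow_one] at h1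
  exact (integrable_norm_iff continuous_id.aestronglyMeasurable).1 h1

lemma integrable_bracket_rpow {μ : Measure ℝ} [IsFiniteMeasure μ] {s : ℝ} (hs : 0 ≤ s)
    (h : Integrable (fun x : ℝ => |x| ^ s) μ) : Integrable (fun x : ℝ => bracket x ^ s) μ := by
  refine (((integrable_const (1 : ℝ)).add h).const_mul (2 ^ s)).mono'
    (continuous_bracket.rpow_const fun _ => Or.inr hs).aestronglyMeasurable
    (Eventually.of_forall fun x => ?_)
  have hb : 0 ≤ bracket x := zero_le_one.trans (one_le_bracket x)
  rw [Real.norm_of_nonneg (Real.rpow_nonneg hb s)]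
  refine (Real.rpow_le_rpow hb (bracket_le x) hs).trans ?_
  simpa using rpow_add_le zero_le_one (abs_nonneg x) hs

/-- The convex order passes to squares of measures, for integrands convex in each variable
separately. -/
lemma ConvexLE.lintegral_prod_le {μ ν : Measure ℝ} [SFinite μ] [SFinite ν] (h : ConvexLE μ ν)
    {f : ℝ × ℝ → ℝ} (hf : Continuous f) (h0 : ∀ p, 0 ≤ f p)
    (h1 : ∀ y, ConvexOn ℝ univ (fun x => f (x, y)))
    (h2 : ∀ x, ConvexOn ℝ univ (fun y => f (x, y))) :
    ∫⁻ p, ENNReal.ofReal (f p) ∂(μ.prod μ) ≤ ∫⁻ p, ENNReal.ofReal (f p) ∂(ν.prod ν) := by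
  have hm : Measurable (fun p => ENNReal.ofReal (f p)) := hf.measurable.ennreal_ofReal
  calc ∫⁻ p, ENNReal.ofReal (f p) ∂(μ.prod μ)
      = ∫⁻ x, ∫⁻ y, ENNReal.ofReal (f (x, y)) ∂μ ∂μ := lintegral_prod _ hm.aemeasurable
    _ ≤ ∫⁻ x, ∫⁻ y, ENNReal.ofReal (f (x, y)) ∂ν ∂μ :=
        lintegral_mono fun x => h _ (h2 x) (fun y => h0 _) (by fun_prop)
    _ = ∫⁻ y, ∫⁻ x, ENNReal.ofReal (f (x, y)) ∂μ ∂ν :=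
        lintegral_lintegral_swap hm.aemeasurable
    _ ≤ ∫⁻ y, ∫⁻ x, ENNReal.ofReal (f (x, y)) ∂ν ∂ν :=
        lintegral_mono fun y => h _ (h1 y) (fun x => h0 _) (by fun_prop)
    _ = ∫⁻ p, ENNReal.ofReal (f p) ∂(ν.prod ν) := (lintegral_prod_symm _ hm.aemeasurable).symm

/-- Affine functions are limits of their positive parts up to constants, so the convex order
compares their integrals even though they are not nonnegative. -/
lemma ConvexLE.integral_mul_le {μ ν : Measure ℝ} [IsProbabilityMeasure μ] [IsProbabilityMeasure ν]
    (h : ConvexLE μ ν) (hμ : Integrable (fun x : ℝ => x) μ) (hν : Integrable (fun x : ℝ => x) ν)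
    (σ : ℝ) : ∫ x, σ * x ∂μ ≤ ∫ x, σ * x ∂ν := by
  have hi : ∀ (c : ℝ) (ρ : Measure ℝ) [IsProbabilityMeasure ρ], Integrable (fun x : ℝ => x) ρ →
      Integrable (fun x => σ * x + c) ρ := fun c ρ _ hρ =>
    (hρ.const_mul σ).add (integrable_const c)
  have key : ∀ n : ℕ, ∫ x, σ * x ∂μ ≤ ∫ x, σ * x ∂ν + ∫ x, max (-(σ * x + n)) 0 ∂ν := by
    intro n
    have hconv : ConvexOn ℝ univ (fun x : ℝ => max (σ * x + n) 0) := by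
      refine ConvexOn.sup ?_ (convexOn_const _ convex_univ)
      refine ⟨convex_univ, fun x _ y _ a b _ _ hab => le_of_eq ?_⟩
      simp only [smul_eq_mul]
      linear_combination -(n : ℝ) * hab
    have h1 := h.integral_le hconv (fun x => le_max_right _ _) (by fun_prop)
      (hi n ν hν).pos_part
    have h2 : ∫ x, σ * x ∂μ + n ≤ ∫ x, max (σ * x + n) 0 ∂μ := by
      have : ∫ x, (σ * x + n) ∂μ = ∫ x, σ * x ∂μ + n := by
        rw [integral_add (hμ.const_mul σ) (integrable_const _)]; simp
      rw [← this]
      exact integral_mono (hi n μ hμ) (hi n μ hμ).pos_part fun x => le_max_left _ _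
    have h3 : ∫ x, max (σ * x + n) 0 ∂ν = ∫ x, σ * x ∂ν + n + ∫ x, max (-(σ * x + n)) 0 ∂ν := by
      have e1 : ∫ x, (σ * x + n) ∂ν = ∫ x, σ * x ∂ν + n := by
        rw [integral_add (hν.const_mul σ) (integrable_const _)]; simp
      rw [← e1, ← integral_add (hi n ν hν) (hi n ν hν).neg_part]
      refine integral_congr_ae (Eventually.of_forall fun x => ?_)
      simp only
      rcases le_total 0 (σ * x + n) with h | h
      · rw [max_eq_left h, max_eq_right (by linarith)]; ring
      · rw [max_eq_right h, max_eq_left (by linarith)]; ring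
    linarith
  have lim : Tendsto (fun n : ℕ => ∫ x, max (-(σ * x + n)) 0 ∂ν) atTop (𝓝 (∫ _, (0 : ℝ) ∂ν)) := by
    refine tendsto_integral_of_dominated_convergence (fun x => |σ * x|)
      (fun n => (by fun_prop : Continuous fun x : ℝ => max (-(σ * x + n)) 0).aestronglyMeasurable)
      (hν.const_mul σ).abs
      (fun n => Eventually.of_forall fun x => ?_) (Eventually.of_forall fun x => ?_)
    · rw [Real.norm_of_nonneg (le_max_right _ _)]
      refine max_le ?_ (abs_nonneg _)
      have := neg_abs_le (σ * x)
      have : (0 : ℝ) ≤ n := n.cast_nonneg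
      linarith
    · refine tendsto_const_nhds.congr' ?_
      filter_upwards [eventually_ge_atTop ⌈|σ * x|⌉₊] with n hn
      have h1 : |σ * x| ≤ n := (Nat.le_ceil _).trans (by exact_mod_cast hn)
      have := neg_abs_le (σ * x)
      rw [max_eq_right (by linarith)]
  rw [integral_zero] at lim
  have := ge_of_tendsto' (lim.const_add (∫ x, σ * x ∂ν)) key
  simpa using this

/-- Measures comparable in the convex order have the same mean. -/
lemma ConvexLE.integral_id_eq {μ ν : Measure ℝ} [IsProbabilityMeasure μ] [IsProbabilityMeasure ν]
    (h : ConvexLE μ ν) (hμ : Integrable (fun x : ℝ => x) μ) (hν : Integrable (fun x : ℝ => x) ν) :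
    ∫ x, x ∂μ = ∫ x, x ∂ν := by
  have h1 := h.integral_mul_le hμ hν 1
  have h2 := h.integral_mul_le hμ hν (-1)
  rw [integral_const_mul, integral_const_mul] at h1 h2
  linarith

/-! ### Uniform integrability of the collision kernel -/

/-- The part of `|x - y|ˢ` above the level `R`. -/
noncomputable def excess (s R : ℝ) (p : ℝ × ℝ) : ℝ := max (|p.1 - p.2| ^ s - R) 0

/-- The collision kernel `|x - y|^γ` truncated at the level `R`. -/
noncomputable def cutKernel (γ R : ℝ) (p : ℝ × ℝ) : ℝ := min (|p.1 - p.2| ^ γ) R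

lemma excess_nonneg (s R : ℝ) (p : ℝ × ℝ) : 0 ≤ excess s R p := le_max_right _ _

lemma continuous_kernel {s : ℝ} (hs : 0 ≤ s) : Continuous fun p : ℝ × ℝ => |p.1 - p.2| ^ s :=
  (by fun_prop : Continuous fun p : ℝ × ℝ => |p.1 - p.2|).rpow_const fun _ => Or.inr hs

lemma continuous_excess {s R : ℝ} (hs : 0 ≤ s) : Continuous (excess s R) :=
  ((continuous_kernel hs).sub continuous_const).max continuous_const

lemma continuous_cutKernel {s R : ℝ} (hs : 0 ≤ s) : Continuous (cutKernel s R) :=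
  (continuous_kernel hs).min continuous_const

lemma kernel_nonneg (γ : ℝ) (p : ℝ × ℝ) : 0 ≤ |p.1 - p.2| ^ γ := Real.rpow_nonneg (abs_nonneg _) _

lemma cutKernel_nonneg (γ : ℝ) {R : ℝ} (hR : 0 ≤ R) (p : ℝ × ℝ) : 0 ≤ cutKernel γ R p :=
  le_min (kernel_nonneg γ p) hR

lemma excess_le_kernel (s : ℝ) {R : ℝ} (hR : 0 ≤ R) (p : ℝ × ℝ) :
    excess s R p ≤ |p.1 - p.2| ^ s :=
  max_le (by linarith) (kernel_nonneg s p)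

/-- For truncation levels at least `1` the part of the kernel that is cut off is controlled by
the excess of the higher power `s`. -/
lemma kernel_le_add_excess {γ s R : ℝ} (hγ : 0 < γ) (hs : γ ≤ s) (hR : 1 ≤ R) (p : ℝ × ℝ) :
    |p.1 - p.2| ^ γ ≤ R + excess s R p := by
  unfold excess
  rcases le_total (|p.1 - p.2|) 1 with h | h
  · have := Real.rpow_le_one (abs_nonneg _) h hγ.le
    linarith [le_max_right (|p.1 - p.2| ^ s - R) 0]
  · have := Real.rpow_le_rpow_of_exponent_le h hs
    linarith [le_max_left (|p.1 - p.2| ^ s - R) 0]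

lemma integrable_kernel {μ : Measure ℝ} [IsFiniteMeasure μ] {s : ℝ} (hs : 0 ≤ s)
    (h : Integrable (fun x : ℝ => |x| ^ s) μ) :
    Integrable (fun p : ℝ × ℝ => |p.1 - p.2| ^ s) (μ.prod μ) := by
  refine (((h.comp_fst μ).add (h.comp_snd μ)).const_mul (2 ^ s)).mono'
    (continuous_kernel hs).aestronglyMeasurable (Eventually.of_forall fun p => ?_)
  rw [Real.norm_of_nonneg (kernel_nonneg s p)]
  exact abs_sub_rpow_le p.1 p.2 hs

/-- The integral of the excess of `|x - y|ˢ` above `R`. -/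
noncomputable def excessInt (s R : ℝ) (μ : Measure ℝ) : ℝ := ∫ p, excess s R p ∂(μ.prod μ)

lemma excessInt_nonneg (s R : ℝ) (μ : Measure ℝ) : 0 ≤ excessInt s R μ :=
  integral_nonneg (excess_nonneg s R)

lemma integrable_excess {μ : Measure ℝ} [IsFiniteMeasure μ] {s R : ℝ} (hs : 0 ≤ s) (hR : 0 ≤ R)
    (h : Integrable (fun x : ℝ => |x| ^ s) μ) : Integrable (excess s R) (μ.prod μ) := by
  refine (integrable_kernel hs h).mono' (continuous_excess hs).aestronglyMeasurable
    (Eventually.of_forall fun p => ?_)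
  rw [Real.norm_of_nonneg (excess_nonneg s R p)]
  exact excess_le_kernel s hR p

lemma tendsto_excessInt {μ : Measure ℝ} [IsFiniteMeasure μ] {s : ℝ} (hs : 0 ≤ s)
    (h : Integrable (fun x : ℝ => |x| ^ s) μ) :
    Tendsto (fun R => excessInt s R μ) atTop (𝓝 0) := by
  rw [show (0 : ℝ) = ∫ _, (0 : ℝ) ∂(μ.prod μ) by simp]
  refine tendsto_integral_filter_of_dominated_convergence (fun p => |p.1 - p.2| ^ s)
    (Eventually.of_forall fun R => (continuous_excess hs).aestronglyMeasurable) ?_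
    (integrable_kernel hs h) (Eventually.of_forall fun p => ?_)
  · filter_upwards [eventually_ge_atTop 0] with R hR
    refine Eventually.of_forall fun p => ?_
    rw [Real.norm_of_nonneg (excess_nonneg s R p)]
    exact excess_le_kernel s hR p
  · refine tendsto_const_nhds.congr' ?_
    filter_upwards [eventually_ge_atTop (|p.1 - p.2| ^ s)] with R hR
    exact (max_eq_right (by linarith)).symm

lemma convexOn_excess {s : ℝ} (hs : 1 ≤ s) (R y : ℝ) :
    ConvexOn ℝ univ (fun x => excess s R (x, y)) := by
  refine ConvexOn.sup ?_ (convexOn_const _ convex_univ)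
  have := convexOn_rpow_of_nonneg (convexOn_abs_sub y) (fun x => abs_nonneg _) hs
  exact this.add_const (-R)

lemma excess_swap (s R x y : ℝ) : excess s R (x, y) = excess s R (y, x) := by
  simp only [excess, abs_sub_comm]

lemma ConvexLE.lintegral_excess_le {μ ν : Measure ℝ} [SFinite μ] [SFinite ν] (h : ConvexLE μ ν)
    {s : ℝ} (hs : 1 ≤ s) (R : ℝ) :
    ∫⁻ p, ENNReal.ofReal (excess s R p) ∂(μ.prod μ) ≤
      ∫⁻ p, ENNReal.ofReal (excess s R p) ∂(ν.prod ν) :=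
  h.lintegral_prod_le (continuous_excess (by linarith)) (excess_nonneg s R)
    (convexOn_excess hs R) (fun x => by
      simpa only [excess_swap s R x] using convexOn_excess hs R x)

/-- The tails of `|x - y|ˢ` do not grow along the convex order: this is the uniform integrability
that makes the unbounded collision kernel harmless. -/
lemma ConvexLE.excessInt_le {μ ν : Measure ℝ} [IsFiniteMeasure μ] [IsFiniteMeasure ν]
    (h : ConvexLE μ ν) {s R : ℝ} (hs : 1 ≤ s) (hR : 0 ≤ R)
    (hν : Integrable (fun x : ℝ => |x| ^ s) ν) : excessInt s R μ ≤ excessInt s R ν := by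
  have hs0 : 0 ≤ s := by linarith
  have hμ := h.integrable (convexOn_abs_rpow hs) (fun x => Real.rpow_nonneg (abs_nonneg x) s)
    (continuous_abs_rpow hs0) hν
  rw [← ENNReal.ofReal_le_ofReal_iff (excessInt_nonneg s R ν), excessInt, excessInt,
    ofReal_integral_eq_lintegral_ofReal (integrable_excess hs0 hR hμ)
      (Eventually.of_forall (excess_nonneg s R)),
    ofReal_integral_eq_lintegral_ofReal (integrable_excess hs0 hR hν)
      (Eventually.of_forall (excess_nonneg s R))]
  exact h.lintegral_excess_le hs R

/-! ### The weak collision operator with a general kernel -/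

/-- The quadratic collision operator in weak form with collision kernel `k`. -/
noncomputable def weakQ (a : ℝ) (k : ℝ × ℝ → ℝ) (μ : Measure ℝ) (φ : ℝ → ℝ) : ℝ :=
  (1 / 2) * ∫ p : ℝ × ℝ, k p * collisionDelta a φ p.1 p.2 ∂(μ.prod μ)

lemma collisionQ_eq_weakQ (a γ : ℝ) (μ : Measure ℝ) (φ : ℝ → ℝ) :
    collisionQ a γ μ μ φ = weakQ a (fun p => |p.1 - p.2| ^ γ) μ φ := rfl

/-- The first post-collisional velocity; the second one is obtained by exchanging the arguments. -/
def post (a : ℝ) (p : ℝ × ℝ) : ℝ := a * p.1 + (1 - a) * p.2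

lemma continuous_post (a : ℝ) : Continuous (post a) := by unfold post; fun_prop

lemma collisionDelta_eq (a : ℝ) (φ : ℝ → ℝ) (p : ℝ × ℝ) :
    collisionDelta a φ p.1 p.2 = φ (post a p) + φ (post a p.swap) - φ p.1 - φ p.2 := by
  simp only [collisionDelta, post, Prod.fst_swap, Prod.snd_swap]
  rw [add_comm ((1 - a) * p.1)]

lemma continuous_collisionDelta (a : ℝ) {φ : ℝ → ℝ} (hφ : Continuous φ) :
    Continuous fun p : ℝ × ℝ => collisionDelta a φ p.1 p.2 := by
  unfold collisionDelta; fun_prop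

lemma abs_collisionDelta_le (a : ℝ) (φ : ℝ →ᵇ ℝ) (x y : ℝ) :
    |collisionDelta a φ x y| ≤ 4 * ‖φ‖ := by
  unfold collisionDelta
  have h := fun z => abs_le.1 ((Real.norm_eq_abs _).symm.le.trans (φ.norm_coe_le_norm z))
  have h1 := h (a * x + (1 - a) * y)
  have h2 := h ((1 - a) * x + a * y)
  have h3 := h x
  have h4 := h y
  rw [abs_le]; constructor <;> linarith

lemma integrable_mul_of_bounded {μ : Measure (ℝ × ℝ)} {k g : ℝ × ℝ → ℝ} (hk : Integrable k μ)
    (hg : Continuous g) {C : ℝ} (hC : ∀ p, |g p| ≤ C) : Integrable (fun p => k p * g p) μ :=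
  hk.mul_bdd (c := C) hg.aestronglyMeasurable (Eventually.of_forall hC)

lemma integrable_mul_collisionDelta {μ : Measure (ℝ × ℝ)} {k : ℝ × ℝ → ℝ} (hk : Integrable k μ)
    (a : ℝ) (φ : ℝ →ᵇ ℝ) : Integrable (fun p => k p * collisionDelta a φ p.1 p.2) μ :=
  integrable_mul_of_bounded hk (continuous_collisionDelta a φ.continuous)
    fun p => abs_collisionDelta_le a φ p.1 p.2

lemma abs_weakQ_sub_le {a : ℝ} {k l e : ℝ × ℝ → ℝ} {μ : Measure ℝ}
    (hk : Integrable k (μ.prod μ)) (hl : Integrable l (μ.prod μ)) (he : Integrable e (μ.prod μ))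
    (hkl : ∀ p, |k p - l p| ≤ e p) (φ : ℝ →ᵇ ℝ) :
    |weakQ a k μ φ - weakQ a l μ φ| ≤ 2 * ‖φ‖ * ∫ p, e p ∂(μ.prod μ) := by
  unfold weakQ
  rw [← mul_sub, ← integral_sub (integrable_mul_collisionDelta hk a φ)
    (integrable_mul_collisionDelta hl a φ), abs_mul]
  have : |∫ p : ℝ × ℝ, (k p * collisionDelta a φ p.1 p.2 - l p * collisionDelta a φ p.1 p.2)
      ∂(μ.prod μ)| ≤ ∫ p, e p * (4 * ‖φ‖) ∂(μ.prod μ) := by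
    rw [← Real.norm_eq_abs]
    refine norm_integral_le_of_norm_le (he.mul_const _) (Eventually.of_forall fun p => ?_)
    rw [← sub_mul, Real.norm_eq_abs, abs_mul]
    exact mul_le_mul (hkl p) (abs_collisionDelta_le a φ _ _) (abs_nonneg _)
      ((abs_nonneg _).trans (hkl p))
  rw [integral_mul_const] at this
  rw [abs_of_pos (by norm_num : (0 : ℝ) < 1 / 2)]
  linarith

lemma abs_weakQ_le {a : ℝ} {k e : ℝ × ℝ → ℝ} {μ : Measure ℝ}
    (hk : Integrable k (μ.prod μ)) (he : Integrable e (μ.prod μ))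
    (hke : ∀ p, |k p| ≤ e p) (φ : ℝ →ᵇ ℝ) :
    |weakQ a k μ φ| ≤ 2 * ‖φ‖ * ∫ p, e p ∂(μ.prod μ) := by
  have := abs_weakQ_sub_le (a := a) (l := fun _ => 0) hk (integrable_zero _ _ _) he
    (by simpa using hke) φ
  simpa [weakQ] using this

lemma weakQ_const_mul (a c : ℝ) (k : ℝ × ℝ → ℝ) (μ : Measure ℝ) (φ : ℝ → ℝ) :
    weakQ a (fun p => c * k p) μ φ = c * weakQ a k μ φ := by
  unfold weakQ
  simp only [mul_assoc]
  rw [integral_const_mul]; ring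

/-- By symmetry of the kernel, the weak collision operator is a gain term minus a loss term. -/
lemma weakQ_eq_gain_sub_loss (a : ℝ) {k : ℝ × ℝ → ℝ} {μ : Measure ℝ} [SFinite μ]
    (hk : Integrable k (μ.prod μ)) (hs : ∀ p, k p.swap = k p) (φ : ℝ →ᵇ ℝ) :
    weakQ a k μ φ = ∫ p, k p * φ (post a p) ∂(μ.prod μ) - ∫ p, k p * φ p.1 ∂(μ.prod μ) := by
  have b : ∀ z, |φ z| ≤ ‖φ‖ := fun z => φ.norm_coe_le_norm z
  have c1 : Continuous fun p => φ (post a p) := φ.continuous.comp (continuous_post a)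
  have i1 := integrable_mul_of_bounded hk c1 (fun p => b _)
  have i2 : Integrable (fun p => k p * φ (post a p.swap)) (μ.prod μ) :=
    integrable_mul_of_bounded hk (c1.comp continuous_swap) (fun p => b _)
  have i3 : Integrable (fun p => k p * φ p.1) (μ.prod μ) :=
    integrable_mul_of_bounded hk (φ.continuous.comp continuous_fst) (fun p => b _)
  have i4 : Integrable (fun p => k p * φ p.2) (μ.prod μ) :=
    integrable_mul_of_bounded hk (φ.continuous.comp continuous_snd) (fun p => b _)
  have e2 : ∫ p, k p * φ (post a p.swap) ∂(μ.prod μ) = ∫ p, k p * φ (post a p) ∂(μ.prod μ) := by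
    rw [← integral_prod_swap]
    simp [hs]
  have e4 : ∫ p, k p * φ p.2 ∂(μ.prod μ) = ∫ p, k p * φ p.1 ∂(μ.prod μ) := by
    rw [← integral_prod_swap]
    simp [hs]
  have e : ∫ p : ℝ × ℝ, k p * collisionDelta a φ p.1 p.2 ∂(μ.prod μ) =
      ∫ p, k p * φ (post a p) ∂(μ.prod μ) + ∫ p, k p * φ (post a p.swap) ∂(μ.prod μ)
        - ∫ p, k p * φ p.1 ∂(μ.prod μ) - ∫ p, k p * φ p.2 ∂(μ.prod μ) := by
    rw [← integral_add i1 i2, ← integral_sub, ← integral_sub]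
    rotate_left
    · exact (i1.add i2).sub i3
    · exact i4
    · exact i1.add i2
    · exact i3
    refine integral_congr_ae (Eventually.of_forall fun p => ?_)
    simp only [collisionDelta_eq]
    ring
  rw [weakQ, e, e2, e4]; ring

/-! ### One explicit time step -/

/-- One step of the explicit scheme: a pair `(x, y)` of independent velocities collides with
probability `w (x, y)`, and the first velocity is recorded. -/
noncomputable def step (a : ℝ) (w : ℝ × ℝ → ℝ) (μ : Measure ℝ) : Measure ℝ :=
  ((μ.prod μ).withDensity fun p => ENNReal.ofReal (w p)).map (post a) +
    ((μ.prod μ).withDensity fun p => ENNReal.ofReal (1 - w p)).map Prod.fst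

lemma lintegral_step (a : ℝ) {w : ℝ × ℝ → ℝ} (hw : Continuous w) (μ : Measure ℝ) {φ : ℝ → ℝ≥0∞}
    (hφ : Measurable φ) :
    ∫⁻ x, φ x ∂(step a w μ) = ∫⁻ p, ENNReal.ofReal (w p) * φ (post a p) +
      ENNReal.ofReal (1 - w p) * φ p.1 ∂(μ.prod μ) := by
  have m1 : Measurable fun p => ENNReal.ofReal (w p) := hw.measurable.ennreal_ofReal
  have m2 : Measurable fun p => ENNReal.ofReal (1 - w p) :=
    (continuous_const.sub hw).measurable.ennreal_ofReal
  have m3 : Measurable fun p => φ (post a p) := hφ.comp (continuous_post a).measurable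
  have m4 : Measurable fun p : ℝ × ℝ => φ p.1 := hφ.comp measurable_fst
  rw [step, lintegral_add_measure, lintegral_map hφ (continuous_post a).measurable,
    lintegral_map hφ measurable_fst, lintegral_withDensity_eq_lintegral_mul _ m1 m3,
    lintegral_withDensity_eq_lintegral_mul _ m2 m4, ← lintegral_add_left (m1.mul m3)]
  rfl

lemma ofReal_add_ofReal_one_sub {w : ℝ} (h0 : 0 ≤ w) (h1 : w ≤ 1) :
    ENNReal.ofReal w + ENNReal.ofReal (1 - w) = 1 := by
  rw [← ENNReal.ofReal_add h0 (by linarith)]; simp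

lemma isProbabilityMeasure_step (a : ℝ) {w : ℝ × ℝ → ℝ} (hw : Continuous w) (h0 : ∀ p, 0 ≤ w p)
    (h1 : ∀ p, w p ≤ 1) (μ : Measure ℝ) [IsProbabilityMeasure μ] :
    IsProbabilityMeasure (step a w μ) := by
  constructor
  rw [← lintegral_one, lintegral_step a hw μ measurable_const]
  simp [ofReal_add_ofReal_one_sub (h0 _) (h1 _)]

/-- Collisions replace velocities by convex combinations, hence decrease convex functionals. -/
lemma step_convexLE {a : ℝ} (ha₀ : 0 < a) (ha₁ : a < 1) {w : ℝ × ℝ → ℝ} (hw : Continuous w)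
    (h0 : ∀ p, 0 ≤ w p) (h1 : ∀ p, w p ≤ 1) (hs : ∀ p, w p.swap = w p) (μ : Measure ℝ)
    [IsProbabilityMeasure μ] : ConvexLE (step a w μ) μ := by
  intro φ hφ hφ0 hφc
  set ψ : ℝ → ℝ≥0∞ := fun x => ENNReal.ofReal (φ x) with hψ
  have hm : Measurable ψ := hφc.measurable.ennreal_ofReal
  set F : ℝ × ℝ → ℝ≥0∞ := fun p => ENNReal.ofReal (w p) * ψ (post a p) +
    ENNReal.ofReal (1 - w p) * ψ p.1 with hF
  have m1 : Measurable fun p => ENNReal.ofReal (w p) := hw.measurable.ennreal_ofReal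
  have m2 : Measurable fun p => ENNReal.ofReal (1 - w p) :=
    (continuous_const.sub hw).measurable.ennreal_ofReal
  have hm1 : Measurable fun p : ℝ × ℝ => ψ p.1 := hm.comp measurable_fst
  have hm2 : Measurable fun p : ℝ × ℝ => ψ p.2 := hm.comp measurable_snd
  have hFm : Measurable F := (m1.mul (hm.comp (continuous_post a).measurable)).add
    (m2.mul hm1)
  have key : ∀ p, F p + F p.swap ≤ ψ p.1 + ψ p.2 := by
    intro p
    have hc : ψ (post a p) + ψ (post a p.swap) ≤ ψ p.1 + ψ p.2 := by
      simp only [hψ]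
      rw [← ENNReal.ofReal_add (hφ0 _) (hφ0 _), ← ENNReal.ofReal_add (hφ0 _) (hφ0 _)]
      apply ENNReal.ofReal_le_ofReal
      have e1 := hφ.2 (mem_univ p.1) (mem_univ p.2) ha₀.le (sub_pos.2 ha₁).le (by ring)
      have e2 := hφ.2 (mem_univ p.2) (mem_univ p.1) ha₀.le (sub_pos.2 ha₁).le (by ring)
      simp only [smul_eq_mul] at e1 e2
      simp only [post, Prod.fst_swap, Prod.snd_swap]
      linarith
    calc F p + F p.swap = ENNReal.ofReal (w p) * (ψ (post a p) + ψ (post a p.swap)) +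
          ENNReal.ofReal (1 - w p) * (ψ p.1 + ψ p.2) := by
          simp only [hF, hs, Prod.fst_swap]; ring
      _ ≤ ENNReal.ofReal (w p) * (ψ p.1 + ψ p.2) +
          ENNReal.ofReal (1 - w p) * (ψ p.1 + ψ p.2) := by gcongr
      _ = ψ p.1 + ψ p.2 := by
          rw [← add_mul, ofReal_add_ofReal_one_sub (h0 p) (h1 p), one_mul]
  have e1 : ∫⁻ p, F p.swap ∂(μ.prod μ) = ∫⁻ p, F p ∂(μ.prod μ) := lintegral_prod_swap _
  have e2 : ∫⁻ p : ℝ × ℝ, ψ p.1 ∂(μ.prod μ) = ∫⁻ x, ψ x ∂μ := by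
    rw [lintegral_prod _ hm1.aemeasurable]; simp
  have e3 : ∫⁻ p : ℝ × ℝ, ψ p.2 ∂(μ.prod μ) = ∫⁻ x, ψ x ∂μ := by
    rw [lintegral_prod _ hm2.aemeasurable]; simp
  have h2 : 2 * ∫⁻ p, F p ∂(μ.prod μ) ≤ 2 * ∫⁻ x, ψ x ∂μ := by
    have := lintegral_mono (μ := μ.prod μ) key
    rw [lintegral_add_left hFm, lintegral_add_left hm1, e1, e2, e3] at this
    rwa [two_mul, two_mul]
  rw [lintegral_step a hw μ hm]
  exact (ENNReal.mul_le_mul_iff_right two_ne_zero ofNat_ne_top).1 h2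

lemma integral_step (a : ℝ) {w : ℝ × ℝ → ℝ} (hw : Continuous w) (h0 : ∀ p, 0 ≤ w p)
    (h1 : ∀ p, w p ≤ 1) (hs : ∀ p, w p.swap = w p) (μ : Measure ℝ) [IsProbabilityMeasure μ]
    (φ : ℝ →ᵇ ℝ) : ∫ x, φ x ∂(step a w μ) = ∫ x, φ x ∂μ + weakQ a w μ φ := by
  have hwi : Integrable w (μ.prod μ) :=
    Integrable.of_bound hw.aestronglyMeasurable 1
      (Eventually.of_forall fun p => by rw [Real.norm_of_nonneg (h0 p)]; exact h1 p)
  have b : ∀ z, |φ z| ≤ ‖φ‖ := fun z => φ.norm_coe_le_norm z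
  have m1 : Measurable fun p => ENNReal.ofReal (w p) := hw.measurable.ennreal_ofReal
  have m2 : Measurable fun p => ENNReal.ofReal (1 - w p) :=
    (continuous_const.sub hw).measurable.ennreal_ofReal
  have := isProbabilityMeasure_step a hw h0 h1 μ
  have hi : Integrable (fun x => φ x) (step a w μ) := φ.integrable _
  have i1 := hi.left_of_add_measure
  have i2 := hi.right_of_add_measure
  have i3 : Integrable (fun p => w p * φ p.1) (μ.prod μ) :=
    integrable_mul_of_bounded hwi (φ.continuous.comp continuous_fst) (fun p => b _)
  have i4 : Integrable (fun p : ℝ × ℝ => φ p.1) (μ.prod μ) := (φ.integrable μ).comp_fst μ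
  rw [weakQ_eq_gain_sub_loss a hwi hs, step, integral_add_measure i1 i2,
    integral_map (continuous_post a).aemeasurable φ.continuous.aestronglyMeasurable,
    integral_map measurable_fst.aemeasurable φ.continuous.aestronglyMeasurable,
    integral_withDensity_eq_integral_toReal_smul m1 (by simp),
    integral_withDensity_eq_integral_toReal_smul m2 (by simp)]
  have e1 : ∀ p, (ENNReal.ofReal (w p)).toReal = w p := fun p => ENNReal.toReal_ofReal (h0 p)
  have e2 : ∀ p, (ENNReal.ofReal (1 - w p)).toReal = 1 - w p :=
    fun p => ENNReal.toReal_ofReal (by linarith [h1 p])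
  simp only [e1, e2, smul_eq_mul, sub_mul, one_mul]
  have e3 : ∫ p : ℝ × ℝ, φ p.1 ∂(μ.prod μ) = ∫ x, φ x ∂μ := by
    rw [integral_fun_fst]; simp
  rw [integral_sub i4 i3, e3]
  ring

/-! ### Stability of the collision operator -/

lemma cutKernel_swap (γ R : ℝ) (p : ℝ × ℝ) : cutKernel γ R p.swap = cutKernel γ R p := by
  simp [cutKernel, abs_sub_comm]

/-- Closeness of two probability measures in total variation, tested on bounded continuous
functions of one variable, passes to their squares. -/
lemma abs_integral_prod_sub_le {μ ν : Measure ℝ} [IsProbabilityMeasure μ] [IsProbabilityMeasure ν]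
    {d : ℝ} (h : ∀ φ : ℝ →ᵇ ℝ, |∫ x, φ x ∂μ - ∫ x, φ x ∂ν| ≤ d * ‖φ‖) {g : ℝ × ℝ → ℝ}
    (hg : Continuous g) {C : ℝ} (hC : ∀ p, |g p| ≤ C) :
    |∫ p, g p ∂(μ.prod μ) - ∫ p, g p ∂(ν.prod ν)| ≤ 2 * d * C := by
  have hd : 0 ≤ d := by
    have := (abs_nonneg _).trans (h (BoundedContinuousFunction.const ℝ 1))
    simpa using this
  have hC0 : 0 ≤ C := (abs_nonneg _).trans (hC (0, 0))
  have hi : ∀ (ρ σ : Measure ℝ) [IsProbabilityMeasure ρ] [IsProbabilityMeasure σ],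
      Integrable g (ρ.prod σ) := fun ρ σ _ _ =>
    Integrable.of_bound hg.aestronglyMeasurable C (Eventually.of_forall hC)
  have bd : ∀ (ρ : Measure ℝ) [IsProbabilityMeasure ρ] (f : ℝ → ℝ), (∀ x, |f x| ≤ C) →
      |∫ x, f x ∂ρ| ≤ C := by
    intro ρ _ f hf
    have := norm_integral_le_of_norm_le_const (μ := ρ) (f := f) (C := C) (Eventually.of_forall hf)
    simpa using this
  let G₁ : ℝ →ᵇ ℝ := BoundedContinuousFunction.ofNormedAddCommGroup
    (fun x => ∫ y, g (x, y) ∂μ)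
    (continuous_of_dominated (bound := fun _ => C)
      (fun x => (by fun_prop : Continuous fun y => g (x, y)).aestronglyMeasurable)
      (fun x => Eventually.of_forall fun y => hC _) (integrable_const C)
      (Eventually.of_forall fun y => by fun_prop)) C (fun x => bd μ _ fun y => hC _)
  let G₂ : ℝ →ᵇ ℝ := BoundedContinuousFunction.ofNormedAddCommGroup
    (fun y => ∫ x, g (x, y) ∂ν)
    (continuous_of_dominated (bound := fun _ => C)
      (fun y => (by fun_prop : Continuous fun x => g (x, y)).aestronglyMeasurable)
      (fun y => Eventually.of_forall fun x => hC _) (integrable_const C)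
      (Eventually.of_forall fun x => by fun_prop)) C (fun y => bd ν _ fun x => hC _)
  have n1 : ‖G₁‖ ≤ C := BoundedContinuousFunction.norm_ofNormedAddCommGroup_le _ hC0 _
  have n2 : ‖G₂‖ ≤ C := BoundedContinuousFunction.norm_ofNormedAddCommGroup_le _ hC0 _
  have e1 : ∫ p, g p ∂(μ.prod μ) = ∫ x, G₁ x ∂μ := integral_prod _ (hi μ μ)
  have e2 : ∫ p, g p ∂(ν.prod μ) = ∫ x, G₁ x ∂ν := integral_prod _ (hi ν μ)
  have e3 : ∫ p, g p ∂(ν.prod μ) = ∫ y, G₂ y ∂μ := integral_prod_symm _ (hi ν μ)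
  have e4 : ∫ p, g p ∂(ν.prod ν) = ∫ y, G₂ y ∂ν := integral_prod_symm _ (hi ν ν)
  have h1 := (h G₁).trans (mul_le_mul_of_nonneg_left n1 hd)
  have h2 := (h G₂).trans (mul_le_mul_of_nonneg_left n2 hd)
  rw [← e1, ← e2] at h1
  rw [← e3, ← e4] at h2
  have := abs_sub_le (∫ p, g p ∂(μ.prod μ)) (∫ p, g p ∂(ν.prod μ)) (∫ p, g p ∂(ν.prod ν))
  linarith

lemma abs_weakQ_cutKernel_sub_le {a γ R d : ℝ} (hγ : 0 ≤ γ) (hR : 0 ≤ R) {μ ν : Measure ℝ}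
    [IsProbabilityMeasure μ] [IsProbabilityMeasure ν]
    (h : ∀ φ : ℝ →ᵇ ℝ, |∫ x, φ x ∂μ - ∫ x, φ x ∂ν| ≤ d * ‖φ‖) (φ : ℝ →ᵇ ℝ) :
    |weakQ a (cutKernel γ R) μ φ - weakQ a (cutKernel γ R) ν φ| ≤ 4 * R * d * ‖φ‖ := by
  have hC : ∀ p : ℝ × ℝ, |cutKernel γ R p * collisionDelta a φ p.1 p.2| ≤ R * (4 * ‖φ‖) := by
    intro p
    rw [abs_mul, abs_of_nonneg (cutKernel_nonneg γ hR p)]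
    exact mul_le_mul (min_le_right _ _) (abs_collisionDelta_le a φ _ _) (abs_nonneg _) hR
  have hc : Continuous fun p : ℝ × ℝ => cutKernel γ R p * collisionDelta a φ p.1 p.2 :=
    (continuous_cutKernel hγ).mul (continuous_collisionDelta a φ.continuous)
  have := abs_integral_prod_sub_le h hc hC
  unfold weakQ
  rw [← mul_sub, abs_mul, abs_of_pos (by norm_num : (0 : ℝ) < 1 / 2)]
  linarith

lemma integrable_cutKernel {γ R : ℝ} (hγ : 0 ≤ γ) (hR : 0 ≤ R) (μ : Measure (ℝ × ℝ))
    [IsFiniteMeasure μ] : Integrable (cutKernel γ R) μ :=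
  Integrable.of_bound (continuous_cutKernel hγ).aestronglyMeasurable R
    (Eventually.of_forall fun p => by
      rw [Real.norm_of_nonneg (cutKernel_nonneg γ hR p)]; exact min_le_right _ _)

lemma abs_cutKernel_sub_le {γ s R R' : ℝ} (hγ : 0 < γ) (hs : γ ≤ s) (hR : 1 ≤ R) (hRR : R ≤ R')
    (p : ℝ × ℝ) : |cutKernel γ R' p - cutKernel γ R p| ≤ excess s R p := by
  have h1 := kernel_le_add_excess hγ hs hR p
  have h2 := excess_nonneg s R p
  unfold cutKernel
  rw [abs_of_nonneg (sub_nonneg.2 (min_le_min_left _ hRR))]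
  rcases le_total (|p.1 - p.2| ^ γ) R with h | h
  · rw [min_eq_left h, min_eq_left (h.trans hRR)]; linarith
  · rw [min_eq_right h]; linarith [min_le_left (|p.1 - p.2| ^ γ) R']

lemma abs_kernel_sub_le {γ s R : ℝ} (hγ : 0 < γ) (hs : γ ≤ s) (hR : 1 ≤ R) (p : ℝ × ℝ) :
    |(|p.1 - p.2| ^ γ) - cutKernel γ R p| ≤ excess s R p := by
  have := abs_cutKernel_sub_le hγ hs hR (le_max_left R (|p.1 - p.2| ^ γ)) p
  rwa [cutKernel, min_eq_left (le_max_right _ _)] at this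

/-- Replacing the collision kernel by its truncation costs no more than the excess of the
dominating measure. -/
lemma abs_weakQ_sub_cutKernel_le {a γ s R : ℝ} (hγ : 0 < γ) (hs1 : 1 ≤ s)
    (hR : 1 ≤ R) {μ₀ μ : Measure ℝ} [IsProbabilityMeasure μ₀] [IsProbabilityMeasure μ]
    (h₀ : Integrable (fun x : ℝ => |x| ^ s) μ₀) (h : ConvexLE μ μ₀) {k : ℝ × ℝ → ℝ}
    (hk : Integrable k (μ.prod μ)) (hkR : ∀ p, |k p - cutKernel γ R p| ≤ excess s R p)
    (φ : ℝ →ᵇ ℝ) :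
    |weakQ a k μ φ - weakQ a (cutKernel γ R) μ φ| ≤ 2 * ‖φ‖ * excessInt s R μ₀ := by
  have hi := h.integrable (convexOn_abs_rpow hs1) (fun x => Real.rpow_nonneg (abs_nonneg x) s)
    (continuous_abs_rpow (by linarith)) h₀
  refine (abs_weakQ_sub_le hk (integrable_cutKernel hγ.le (by linarith) _)
    (integrable_excess (by linarith) (by linarith) hi) hkR φ).trans ?_
  exact mul_le_mul_of_nonneg_left (h.excessInt_le hs1 (by linarith) h₀) (by positivity)

/-- The collision operator is continuous in total variation, uniformly on the set of measures
dominated by `μ₀` in the convex order. -/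
lemma abs_weakQ_sub_weakQ_le {a γ s R d : ℝ} (hγ : 0 < γ) (hs1 : 1 ≤ s)
    (hR : 1 ≤ R) {μ₀ μ ν : Measure ℝ} [IsProbabilityMeasure μ₀] [IsProbabilityMeasure μ]
    [IsProbabilityMeasure ν] (h₀ : Integrable (fun x : ℝ => |x| ^ s) μ₀)
    (hμ : ConvexLE μ μ₀) (hν : ConvexLE ν μ₀) {k : ℝ × ℝ → ℝ}
    (hkμ : Integrable k (μ.prod μ)) (hkν : Integrable k (ν.prod ν))
    (hkR : ∀ p, |k p - cutKernel γ R p| ≤ excess s R p)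
    (hd : ∀ φ : ℝ →ᵇ ℝ, |∫ x, φ x ∂μ - ∫ x, φ x ∂ν| ≤ d * ‖φ‖) (φ : ℝ →ᵇ ℝ) :
    |weakQ a k μ φ - weakQ a k ν φ| ≤ ‖φ‖ * (4 * excessInt s R μ₀ + 4 * R * d) := by
  have h1 := abs_weakQ_sub_cutKernel_le (a := a) hγ hs1 hR h₀ hμ hkμ hkR φ
  have h2 := abs_weakQ_sub_cutKernel_le (a := a) hγ hs1 hR h₀ hν hkν hkR φ
  have h3 := abs_weakQ_cutKernel_sub_le (a := a) hγ.le (by linarith : (0 : ℝ) ≤ R) hd φ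
  rw [abs_sub_comm] at h2
  have h4 := abs_sub_le (weakQ a k μ φ) (weakQ a (cutKernel γ R) μ φ) (weakQ a k ν φ)
  have h5 := abs_sub_le (weakQ a (cutKernel γ R) μ φ) (weakQ a (cutKernel γ R) ν φ)
    (weakQ a k ν φ)
  linarith

/-- The total variation speed bound available for measures dominated by `μ₀`. -/
noncomputable def speed (s : ℝ) (μ₀ : Measure ℝ) : ℝ := 2 * (1 + excessInt s 1 μ₀)

lemma speed_nonneg (s : ℝ) (μ₀ : Measure ℝ) : 0 ≤ speed s μ₀ := by
  have := excessInt_nonneg s 1 μ₀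
  unfold speed; linarith

lemma abs_weakQ_le_speed {a γ s : ℝ} (hγ : 0 < γ) (hs : γ ≤ s) (hs1 : 1 ≤ s)
    {μ₀ μ : Measure ℝ} [IsProbabilityMeasure μ₀] [IsProbabilityMeasure μ]
    (h₀ : Integrable (fun x : ℝ => |x| ^ s) μ₀) (h : ConvexLE μ μ₀) {k : ℝ × ℝ → ℝ}
    (hk : Integrable k (μ.prod μ)) (hk0 : ∀ p, 0 ≤ k p) (hk1 : ∀ p, k p ≤ |p.1 - p.2| ^ γ)
    (φ : ℝ →ᵇ ℝ) : |weakQ a k μ φ| ≤ speed s μ₀ * ‖φ‖ := by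
  have hi := h.integrable (convexOn_abs_rpow hs1) (fun x => Real.rpow_nonneg (abs_nonneg x) s)
    (continuous_abs_rpow (by linarith)) h₀
  have hx : Integrable (excess s 1) (μ.prod μ) := integrable_excess (by linarith) zero_le_one hi
  have hx1 : Integrable (fun p => 1 + excess s 1 p) (μ.prod μ) := (integrable_const (1 : ℝ)).add hx
  have := abs_weakQ_le (a := a) hk hx1 (fun p => by
    rw [abs_of_nonneg (hk0 p)]
    exact (hk1 p).trans (kernel_le_add_excess hγ hs le_rfl p)) φ
  have e : ∫ p, (1 + excess s 1 p) ∂(μ.prod μ) = 1 + excessInt s 1 μ := by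
    rw [integral_add (integrable_const _) hx]; simp [excessInt]
  rw [e] at this
  have h2 := h.excessInt_le hs1 zero_le_one h₀
  refine this.trans ?_
  unfold speed
  nlinarith [norm_nonneg φ]

/-! ### The explicit scheme -/

/-- The time step of the explicit scheme at truncation level `n + 1`. -/
noncomputable def timeStep (n : ℕ) : ℝ := 1 / ((n : ℝ) + 1) ^ 2

lemma timeStep_nonneg (n : ℕ) : 0 ≤ timeStep n := by unfold timeStep; positivity

/-- The explicit scheme for the kernel truncated at level `n + 1`, with time step small enough for
collision probabilities to be at most `1`. -/
noncomputable def eulerSeq (a γ : ℝ) (μ₀ : Measure ℝ) (n : ℕ) : ℕ → Measure ℝ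
  | 0 => μ₀
  | k + 1 => step a (fun p => timeStep n * cutKernel γ (n + 1) p) (eulerSeq a γ μ₀ n k)

lemma continuous_collisionProb {γ : ℝ} (hγ : 0 ≤ γ) (n : ℕ) :
    Continuous fun p => timeStep n * cutKernel γ (n + 1) p :=
  continuous_const.mul (continuous_cutKernel hγ)

lemma collisionProb_nonneg (γ : ℝ) (n : ℕ) (p : ℝ × ℝ) :
    0 ≤ timeStep n * cutKernel γ (n + 1) p :=
  mul_nonneg (timeStep_nonneg n) (cutKernel_nonneg γ (by positivity) p)

lemma collisionProb_le_one (γ : ℝ) (n : ℕ) (p : ℝ × ℝ) :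
    timeStep n * cutKernel γ (n + 1) p ≤ 1 := by
  have h1 : cutKernel γ (n + 1) p ≤ (n : ℝ) + 1 := min_le_right _ _
  have h2 : (0 : ℝ) ≤ n := n.cast_nonneg
  refine (mul_le_mul_of_nonneg_left h1 (timeStep_nonneg n)).trans ?_
  unfold timeStep
  rw [div_mul_eq_mul_div, div_le_one (by positivity)]
  nlinarith

lemma collisionProb_swap (γ : ℝ) (n : ℕ) (p : ℝ × ℝ) :
    timeStep n * cutKernel γ (n + 1) p.swap = timeStep n * cutKernel γ (n + 1) p := by
  rw [cutKernel_swap]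

section Scheme

variable {a γ s : ℝ} {μ₀ : Measure ℝ}

lemma isProbabilityMeasure_eulerSeq (hγ : 0 ≤ γ) [IsProbabilityMeasure μ₀] (n k : ℕ) :
    IsProbabilityMeasure (eulerSeq a γ μ₀ n k) := by
  induction k with
  | zero => assumption
  | succ k ih =>
    exact isProbabilityMeasure_step a (continuous_collisionProb hγ n) (collisionProb_nonneg γ n)
      (collisionProb_le_one γ n) _

lemma eulerSeq_convexLE (ha₀ : 0 < a) (ha₁ : a < 1) (hγ : 0 ≤ γ) [IsProbabilityMeasure μ₀]
    (n : ℕ) {j k : ℕ} (hjk : j ≤ k) : ConvexLE (eulerSeq a γ μ₀ n k) (eulerSeq a γ μ₀ n j) := by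
  induction k, hjk using Nat.le_induction with
  | base => exact ConvexLE.refl _
  | succ k _ ih =>
    have := isProbabilityMeasure_eulerSeq (a := a) (μ₀ := μ₀) hγ n k
    exact (step_convexLE ha₀ ha₁ (continuous_collisionProb hγ n) (collisionProb_nonneg γ n)
      (collisionProb_le_one γ n) (collisionProb_swap γ n) _).trans ih

lemma integral_eulerSeq_succ (hγ : 0 ≤ γ) [IsProbabilityMeasure μ₀] (n k : ℕ) (φ : ℝ →ᵇ ℝ) :
    ∫ x, φ x ∂(eulerSeq a γ μ₀ n (k + 1)) = ∫ x, φ x ∂(eulerSeq a γ μ₀ n k) +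
      timeStep n * weakQ a (cutKernel γ (n + 1)) (eulerSeq a γ μ₀ n k) φ := by
  have := isProbabilityMeasure_eulerSeq (a := a) (μ₀ := μ₀) hγ n k
  rw [eulerSeq, integral_step a (continuous_collisionProb hγ n) (collisionProb_nonneg γ n)
      (collisionProb_le_one γ n) (collisionProb_swap γ n), weakQ_const_mul]

lemma abs_integral_eulerSeq_sub_le (ha₀ : 0 < a) (ha₁ : a < 1) (hγ : 0 < γ) (hs : γ ≤ s)
    (hs1 : 1 ≤ s) [IsProbabilityMeasure μ₀] (h₀ : Integrable (fun x : ℝ => |x| ^ s) μ₀) (n : ℕ)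
    (φ : ℝ →ᵇ ℝ) (j i : ℕ) :
    |∫ x, φ x ∂(eulerSeq a γ μ₀ n (j + i)) - ∫ x, φ x ∂(eulerSeq a γ μ₀ n j)| ≤
      speed s μ₀ * (timeStep n * i) * ‖φ‖ := by
  induction i with
  | zero => simp
  | succ i ih =>
    have := isProbabilityMeasure_eulerSeq (a := a) (μ₀ := μ₀) hγ.le n (j + i)
    have hc : ConvexLE (eulerSeq a γ μ₀ n (j + i)) μ₀ :=
      eulerSeq_convexLE ha₀ ha₁ hγ.le n (Nat.zero_le _)
    have hQ := abs_weakQ_le_speed (a := a) hγ hs hs1 h₀ hc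
      (integrable_cutKernel hγ.le (by positivity : (0 : ℝ) ≤ n + 1) _)
      (cutKernel_nonneg γ (by positivity)) (fun p => min_le_left _ _) φ
    rw [← add_assoc, integral_eulerSeq_succ hγ.le, add_sub_right_comm]
    refine (abs_add_le _ _).trans ?_
    rw [abs_mul, abs_of_nonneg (timeStep_nonneg n)]
    have := mul_le_mul_of_nonneg_left hQ (timeStep_nonneg n)
    push_cast
    linarith

/-- Second order expansion of the scheme in time, uniform in the discretisation. -/
lemma abs_integral_eulerSeq_sub_sub_le (ha₀ : 0 < a) (ha₁ : a < 1) (hγ : 0 < γ) (hs : γ ≤ s)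
    (hs1 : 1 ≤ s) [IsProbabilityMeasure μ₀] (h₀ : Integrable (fun x : ℝ => |x| ^ s) μ₀) {n : ℕ}
    {R : ℝ} (hR : 1 ≤ R) (hRn : R ≤ n + 1) (φ : ℝ →ᵇ ℝ) (j N i : ℕ) (hi : i ≤ N) :
    |∫ x, φ x ∂(eulerSeq a γ μ₀ n (j + i)) - ∫ x, φ x ∂(eulerSeq a γ μ₀ n j) -
        timeStep n * i * weakQ a (cutKernel γ (n + 1)) (eulerSeq a γ μ₀ n j) φ| ≤
      timeStep n * i *
        (‖φ‖ * (4 * excessInt s R μ₀ + 4 * R * (speed s μ₀ * (timeStep n * N)))) := by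
  induction i with
  | zero => simp
  | succ i ih =>
    have ih := ih (Nat.le_of_succ_le hi)
    have := isProbabilityMeasure_eulerSeq (a := a) (μ₀ := μ₀) hγ.le n (j + i)
    have := isProbabilityMeasure_eulerSeq (a := a) (μ₀ := μ₀) hγ.le n j
    have hQ := abs_weakQ_sub_weakQ_le (a := a) (d := speed s μ₀ * (timeStep n * N)) hγ hs1 hR h₀
      (eulerSeq_convexLE (a := a) ha₀ ha₁ hγ.le n (Nat.zero_le (j + i)))
      (eulerSeq_convexLE (a := a) ha₀ ha₁ hγ.le n (Nat.zero_le j))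
      (integrable_cutKernel hγ.le (by positivity : (0 : ℝ) ≤ n + 1) _)
      (integrable_cutKernel hγ.le (by positivity : (0 : ℝ) ≤ n + 1) _)
      (abs_cutKernel_sub_le hγ hs hR hRn)
      (fun ψ => (abs_integral_eulerSeq_sub_le ha₀ ha₁ hγ hs hs1 h₀ n ψ j i).trans (by
        have hiN : (i : ℝ) ≤ N := by exact_mod_cast Nat.le_of_succ_le hi
        have := speed_nonneg s μ₀
        have := timeStep_nonneg n
        gcongr)) φ
    rw [← add_assoc, integral_eulerSeq_succ hγ.le]
    set A := ∫ x, φ x ∂(eulerSeq a γ μ₀ n (j + i))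
    set B := ∫ x, φ x ∂(eulerSeq a γ μ₀ n j)
    set Q₁ := weakQ a (cutKernel γ (n + 1)) (eulerSeq a γ μ₀ n (j + i)) φ
    set Q₀ := weakQ a (cutKernel γ (n + 1)) (eulerSeq a γ μ₀ n j) φ
    have e : A + timeStep n * Q₁ - B - timeStep n * (i + 1 : ℕ) * Q₀ =
        (A - B - timeStep n * i * Q₀) + timeStep n * (Q₁ - Q₀) := by push_cast; ring
    rw [e]
    refine (abs_add_le _ _).trans ?_
    rw [abs_mul, abs_of_nonneg (timeStep_nonneg n)]
    have := mul_le_mul_of_nonneg_left hQ (timeStep_nonneg n)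
    push_cast
    linarith

end Scheme

/-! ### Weak limits of measures dominated in the convex order -/

lemma tendsto_integral_of_bounded {Ω : Type*} [MeasurableSpace Ω] [TopologicalSpace Ω]
    [OpensMeasurableSpace Ω] {ι : Type*} {l : Filter ι} {P : ι → ProbabilityMeasure Ω}
    {p : ProbabilityMeasure Ω} (h : Tendsto P l (𝓝 p)) {g : Ω → ℝ} (hg : Continuous g) {C : ℝ}
    (hC : ∀ x, |g x| ≤ C) :
    Tendsto (fun i => ∫ x, g x ∂(P i : Measure Ω)) l (𝓝 (∫ x, g x ∂(p : Measure Ω))) :=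
  ProbabilityMeasure.tendsto_iff_forall_integral_tendsto.1 h
    (BoundedContinuousFunction.ofNormedAddCommGroup g hg C hC)

section Limit

variable {ι : Type*} {l : Filter ι} {P P' : ι → ProbabilityMeasure ℝ} {p p' : ProbabilityMeasure ℝ}

lemma ConvexLE.of_tendsto [l.NeBot] {μ₀ : Measure ℝ} (h : Tendsto P l (𝓝 p))
    (hP : ∀ i, ConvexLE (P i) μ₀) : ConvexLE p μ₀ := by
  intro φ hφ h0 hc
  have key : ∀ N : ℕ, ∫⁻ x, ENNReal.ofReal (min (φ x) N) ∂(p : Measure ℝ) ≤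
      ∫⁻ x, ENNReal.ofReal (φ x) ∂μ₀ := by
    intro N
    have hb : ∀ x, |min (φ x) (N : ℝ)| ≤ N := fun x => by
      rw [abs_of_nonneg (le_min (h0 x) N.cast_nonneg)]; exact min_le_right _ _
    have hcN : Continuous fun x => min (φ x) (N : ℝ) := hc.min continuous_const
    have e : ∀ q : ProbabilityMeasure ℝ, ∫⁻ x, ENNReal.ofReal (min (φ x) N) ∂(q : Measure ℝ) =
        ENNReal.ofReal (∫ x, min (φ x) N ∂(q : Measure ℝ)) := fun q =>
      (ofReal_integral_eq_lintegral_ofReal (Integrable.of_bound hcN.aestronglyMeasurable (N : ℝ)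
        (Eventually.of_forall hb))
        (Eventually.of_forall fun x => le_min (h0 x) N.cast_nonneg)).symm
    have t := (ENNReal.continuous_ofReal.tendsto _).comp (tendsto_integral_of_bounded h hcN hb)
    rw [e]
    refine le_of_tendsto' t fun i => ?_
    rw [Function.comp_apply, ← e]
    refine (lintegral_mono fun x => ?_).trans (hP i φ hφ h0 hc)
    exact ENNReal.ofReal_le_ofReal (min_le_left _ _)
  refine le_of_tendsto' (lintegral_tendsto_of_tendsto_of_monotone
    (f := fun (N : ℕ) x => ENNReal.ofReal (min (φ x) N))
    (fun N => (hc.min continuous_const).measurable.ennreal_ofReal.aemeasurable)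
    (Eventually.of_forall fun x N M hNM => ENNReal.ofReal_le_ofReal
      (min_le_min_left _ (by exact_mod_cast hNM)))
    (Eventually.of_forall fun x => ?_)) key
  refine tendsto_const_nhds.congr' ?_
  filter_upwards [eventually_ge_atTop ⌈φ x⌉₊] with N hN
  rw [min_eq_left ((Nat.le_ceil _).trans (by exact_mod_cast hN))]

lemma tendsto_weakQ_cutKernel (a : ℝ) {γ R : ℝ} (hγ : 0 ≤ γ) (hR : 0 ≤ R) (h : Tendsto P l (𝓝 p))
    (φ : ℝ →ᵇ ℝ) : Tendsto (fun i => weakQ a (cutKernel γ R) (P i) φ) l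
      (𝓝 (weakQ a (cutKernel γ R) p φ)) := by
  have hC : ∀ q : ℝ × ℝ, |cutKernel γ R q * collisionDelta a φ q.1 q.2| ≤ R * (4 * ‖φ‖) := by
    intro q
    rw [abs_mul, abs_of_nonneg (cutKernel_nonneg γ hR q)]
    exact mul_le_mul (min_le_right _ _) (abs_collisionDelta_le a φ _ _) (abs_nonneg _) hR
  have hc : Continuous fun q : ℝ × ℝ => cutKernel γ R q * collisionDelta a φ q.1 q.2 :=
    (continuous_cutKernel hγ).mul (continuous_collisionDelta a φ.continuous)
  have hprod : Tendsto (fun i => (P i).prod (P i)) l (𝓝 (p.prod p)) :=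
    (ProbabilityMeasure.continuous_prod.tendsto (p, p)).comp (h.prodMk_nhds h)
  exact (tendsto_integral_of_bounded hprod hc hC).const_mul (1 / 2)

/-- Weak convergence along measures dominated by `μ₀` passes to the limit in the collision
operator, although the kernel is unbounded and is approximated at the same time. -/
lemma tendsto_weakQ [l.NeBot] {a γ s : ℝ} (hγ : 0 < γ) (hs : γ ≤ s) (hs1 : 1 ≤ s) {μ₀ : Measure ℝ}
    [IsProbabilityMeasure μ₀] (h₀ : Integrable (fun x : ℝ => |x| ^ s) μ₀) (h : Tendsto P l (𝓝 p))
    (hP : ∀ i, ConvexLE (P i) μ₀) {ρ : ι → ℝ} (hρ : Tendsto ρ l atTop) (φ : ℝ →ᵇ ℝ) :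
    Tendsto (fun i => weakQ a (cutKernel γ (ρ i)) (P i) φ) l
      (𝓝 (weakQ a (fun q => |q.1 - q.2| ^ γ) p φ)) := by
  have hp : ConvexLE p μ₀ := ConvexLE.of_tendsto h hP
  have hpi := hp.integrable (convexOn_abs_rpow hs1) (fun x => Real.rpow_nonneg (abs_nonneg x) s)
    (continuous_abs_rpow (by linarith)) h₀
  have hk := integrable_kernel hγ.le (integrable_abs_rpow_of_le hγ.le hs hpi)
  rw [Metric.tendsto_nhds]
  intro ε hε
  have lim : Tendsto (fun R => 2 * ‖φ‖ * excessInt s R μ₀) atTop (𝓝 0) := by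
    simpa using (tendsto_excessInt (by linarith) h₀).const_mul (2 * ‖φ‖)
  obtain ⟨R, hRε, hR⟩ := ((lim.eventually_lt_const (by positivity : (0 : ℝ) < ε / 3)).and
    (eventually_ge_atTop 1)).exists
  have hcut := Metric.tendsto_nhds.1 (tendsto_weakQ_cutKernel a hγ.le (by linarith : (0 : ℝ) ≤ R)
    h φ) (ε / 3) (by positivity)
  filter_upwards [hcut, hρ.eventually_ge_atTop R] with i hi hρi
  have h1 := abs_weakQ_sub_cutKernel_le (a := a) hγ hs1 hR h₀ (hP i)
    (integrable_cutKernel hγ.le (by linarith : (0 : ℝ) ≤ ρ i) _)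
    (abs_cutKernel_sub_le hγ hs hR hρi) φ
  have h2 := abs_weakQ_sub_cutKernel_le (a := a) hγ hs1 hR h₀ hp hk (abs_kernel_sub_le hγ hs hR) φ
  rw [Real.dist_eq] at hi ⊢
  rw [abs_sub_comm] at h2
  have h3 := abs_sub_le (weakQ a (cutKernel γ (ρ i)) (P i) φ) (weakQ a (cutKernel γ R) (P i) φ)
    (weakQ a (fun q => |q.1 - q.2| ^ γ) p φ)
  have h4 := abs_sub_le (weakQ a (cutKernel γ R) (P i) φ) (weakQ a (cutKernel γ R) p φ)
    (weakQ a (fun q => |q.1 - q.2| ^ γ) p φ)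
  linarith

/-- The critical moment is monotone in the limit, since its tails are uniformly small. -/
lemma moment_le_of_tendsto [l.NeBot] {s : ℝ} (hs1 : 1 ≤ s) {μ₀ : Measure ℝ}
    [IsProbabilityMeasure μ₀] (h₀ : Integrable (fun x : ℝ => |x| ^ s) μ₀) (h : Tendsto P l (𝓝 p))
    (h' : Tendsto P' l (𝓝 p')) (hP : ∀ i, ConvexLE (P i) μ₀) (hP' : ∀ i, ConvexLE (P' i) (P i)) :
    moment s p' ≤ moment s p := by
  have hs0 : 0 ≤ s := by linarith
  have n0 : ∀ x : ℝ, 0 ≤ |x| ^ s := fun x => Real.rpow_nonneg (abs_nonneg x) s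
  have hc := continuous_abs_rpow hs0
  have int : ∀ q : ProbabilityMeasure ℝ, ConvexLE q μ₀ →
      Integrable (fun x : ℝ => |x| ^ s) (q : Measure ℝ) := fun q hq =>
    hq.integrable (convexOn_abs_rpow hs1) n0 hc h₀
  have hp : ConvexLE p μ₀ := ConvexLE.of_tendsto h hP
  have hp' : ConvexLE p' μ₀ := ConvexLE.of_tendsto h' fun i => (hP' i).trans (hP i)
  have hcR : ∀ R : ℝ, Continuous fun x : ℝ => min (|x| ^ s) R := fun R => hc.min continuous_const
  have key : ∀ R : ℝ, 0 ≤ R → ∫ x, min (|x| ^ s) R ∂(p' : Measure ℝ) ≤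
      moment s p + ∫ x, max (|x| ^ s - R) 0 ∂μ₀ := by
    intro R hR
    have hb : ∀ x : ℝ, |min (|x| ^ s) R| ≤ R := fun x => by
      rw [abs_of_nonneg (le_min (n0 x) hR)]; exact min_le_right _ _
    have imin : ∀ q : ProbabilityMeasure ℝ, Integrable (fun x : ℝ => min (|x| ^ s) R)
      (q : Measure ℝ) := fun q => Integrable.of_bound (hcR R).aestronglyMeasurable R
        (Eventually.of_forall hb)
    have hconv : ConvexOn ℝ univ (fun x : ℝ => max (|x| ^ s - R) 0) :=
      ConvexOn.sup ((convexOn_abs_rpow hs1).add_const (-R)) (convexOn_const _ convex_univ)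
    have t1 := tendsto_integral_of_bounded h' (hcR R) hb
    have t2 := (tendsto_integral_of_bounded h (hcR R) hb).add_const (∫ x, max (|x| ^ s - R) 0 ∂μ₀)
    have h1 := le_of_tendsto_of_tendsto' t1 t2 fun i => by
      have i1 := int (P i) (hP i)
      have i2 := int (P' i) ((hP' i).trans (hP i))
      calc ∫ x, min (|x| ^ s) R ∂(P' i : Measure ℝ)
          ≤ ∫ x, |x| ^ s ∂(P' i : Measure ℝ) :=
            integral_mono (imin _) i2 fun x => min_le_left _ _
        _ ≤ ∫ x, |x| ^ s ∂(P i : Measure ℝ) :=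
            (hP' i).integral_le (convexOn_abs_rpow hs1) n0 hc i1
        _ = ∫ x, min (|x| ^ s) R ∂(P i : Measure ℝ) +
              ∫ x, max (|x| ^ s - R) 0 ∂(P i : Measure ℝ) := by
            have i3 : Integrable (fun x : ℝ => max (|x| ^ s - R) 0) (P i : Measure ℝ) :=
              (i1.sub (integrable_const R)).pos_part
            rw [← integral_add (imin _) i3]
            refine integral_congr_ae (Eventually.of_forall fun x => ?_)
            simp only
            rcases le_total (|x| ^ s) R with h | h
            · rw [min_eq_left h, max_eq_right (by linarith)]; ring
            · rw [min_eq_right h, max_eq_left (by linarith)]; ring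
        _ ≤ _ := by
            refine add_le_add_right ?_ _
            exact (hP i).integral_le hconv (fun x => le_max_right _ _) (by fun_prop)
              (h₀.sub (integrable_const R)).pos_part
    refine h1.trans ?_
    gcongr
    exact integral_mono (imin _) (int p hp) fun x => min_le_left _ _
  have t1 : Tendsto (fun R : ℝ => ∫ x, min (|x| ^ s) R ∂(p' : Measure ℝ)) atTop
      (𝓝 (moment s p')) := by
    refine tendsto_integral_filter_of_dominated_convergence (fun x : ℝ => |x| ^ s)
      (Eventually.of_forall fun R => (hcR R).aestronglyMeasurable) ?_ (int p' hp')
      (Eventually.of_forall fun x => ?_)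
    · filter_upwards [eventually_ge_atTop 0] with R hR
      refine Eventually.of_forall fun x => ?_
      rw [Real.norm_of_nonneg (le_min (n0 x) hR)]
      exact min_le_left _ _
    · refine tendsto_const_nhds.congr' ?_
      filter_upwards [eventually_ge_atTop (|x| ^ s)] with R hR
      exact (min_eq_left hR).symm
  have t2 : Tendsto (fun R : ℝ => ∫ x, max (|x| ^ s - R) 0 ∂μ₀) atTop
      (𝓝 (∫ _, (0 : ℝ) ∂μ₀)) := by
    refine tendsto_integral_filter_of_dominated_convergence (fun x : ℝ => |x| ^ s)
      (Eventually.of_forall fun R =>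
        ((hc.sub continuous_const).max continuous_const).aestronglyMeasurable) ?_ h₀
      (Eventually.of_forall fun x => ?_)
    · filter_upwards [eventually_ge_atTop 0] with R hR
      refine Eventually.of_forall fun x => ?_
      rw [Real.norm_of_nonneg (le_max_right _ _)]
      exact max_le (by linarith) (n0 x)
    · refine tendsto_const_nhds.congr' ?_
      filter_upwards [eventually_ge_atTop (|x| ^ s)] with R hR
      exact (max_eq_right (by linarith)).symm
  rw [integral_zero] at t2
  have := le_of_tendsto_of_tendsto t1 (t2.const_add (moment s p))
    ((eventually_ge_atTop 0).mono key)
  simpa using this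

end Limit

/-! ### Construction of the flow -/

/-- What survives in the limit of vanishing time step: a curve of probability measures dominated by
the initial datum in the convex order, with an expansion to second order in time whose remainder
is controlled by the initial datum alone. -/
structure IsCollisionFlow (a γ s : ℝ) (μ₀ : Measure ℝ) (m : ℝ → Measure ℝ) : Prop where
  zero : m 0 = μ₀
  prob : ∀ t, IsProbabilityMeasure (m t)
  convexLE : ∀ t, ConvexLE (m t) μ₀
  moment_antitone : ∀ r t, r ≤ t → moment s (m t) ≤ moment s (m r)
  lipschitz : ∀ t r, 0 ≤ t → 0 ≤ r → ∀ φ : ℝ →ᵇ ℝ,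
    |∫ x, φ x ∂(m (t + r)) - ∫ x, φ x ∂(m t)| ≤ speed s μ₀ * r * ‖φ‖
  expansion : ∀ R, 1 ≤ R → ∀ t r, 0 ≤ t → 0 ≤ r → ∀ φ : ℝ →ᵇ ℝ,
    |∫ x, φ x ∂(m (t + r)) - ∫ x, φ x ∂(m t) - r * collisionQ a γ (m t) (m t) φ| ≤
      r * (‖φ‖ * (4 * excessInt s R μ₀ + 4 * R * (speed s μ₀ * r)))

lemma isTightMeasureSet_convexLE {μ₀ : Measure ℝ} (h₀ : Integrable (fun x : ℝ => x) μ₀) :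
    IsTightMeasureSet {μ : Measure ℝ | ConvexLE μ μ₀} := by
  apply isTightMeasureSet_of_tendsto_measure_norm_gt
  set C := ∫⁻ x, ENNReal.ofReal |x| ∂μ₀ with hC
  have hCtop : C ≠ ∞ := by
    have := h₀.abs.2
    rw [hasFiniteIntegral_iff_ofReal (Eventually.of_forall fun x => abs_nonneg x)] at this
    exact this.ne
  have lim : Tendsto (fun r : ℝ => C / ENNReal.ofReal r) atTop (𝓝 0) := by
    have := ENNReal.Tendsto.const_div (a := C) ENNReal.tendsto_ofReal_atTop (Or.inr hCtop)
    simpa using this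
  refine tendsto_of_tendsto_of_tendsto_of_le_of_le' tendsto_const_nhds lim
    (Eventually.of_forall fun _ => zero_le) ?_
  filter_upwards [eventually_gt_atTop 0] with r hr
  refine iSup₂_le fun μ hμ => ?_
  have h1 : μ {x | r < ‖x‖} ≤ μ {x | ENNReal.ofReal r ≤ ENNReal.ofReal |x|} :=
    measure_mono fun x hx => ENNReal.ofReal_le_ofReal (le_of_lt hx)
  refine h1.trans ((meas_ge_le_lintegral_div
    (by fun_prop) (by simpa using hr) ENNReal.ofReal_ne_top).trans ?_)
  gcongr
  exact hμ _ convexOn_abs_univ abs_nonneg continuous_abs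

/-- The number of time steps performed up to time `t`. -/
noncomputable def stepCount (n : ℕ) (t : ℝ) : ℕ := ⌊t * ((n : ℝ) + 1) ^ 2⌋₊

lemma stepCount_mono (n : ℕ) {t r : ℝ} (h : t ≤ r) : stepCount n t ≤ stepCount n r :=
  Nat.floor_le_floor (mul_le_mul_of_nonneg_right h (by positivity))

lemma tendsto_timeStep_mul_stepCount {t : ℝ} (ht : 0 ≤ t) :
    Tendsto (fun n => timeStep n * stepCount n t) atTop (𝓝 t) := by
  have h1 : Tendsto (fun n : ℕ => ((n : ℝ) + 1) ^ 2) atTop atTop :=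
    (tendsto_pow_atTop two_ne_zero).comp
      (tendsto_atTop_add_const_right _ _ tendsto_natCast_atTop_atTop)
  refine ((tendsto_nat_floor_mul_div_atTop ht).comp h1).congr fun n => ?_
  simp only [Function.comp, timeStep, stepCount]
  ring

/-- Existence of the flow, as a limit of the explicit scheme along an ultrafilter. -/
theorem exists_isCollisionFlow {a γ s : ℝ} (ha₀ : 0 < a) (ha₁ : a < 1) (hγ : 0 < γ) (hs : γ ≤ s)
    (hs1 : 1 ≤ s) {μ₀ : Measure ℝ} [IsProbabilityMeasure μ₀]
    (h₀ : Integrable (fun x : ℝ => |x| ^ s) μ₀) :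
    ∃ m : ℝ → Measure ℝ, IsCollisionFlow a γ s μ₀ m := by
  set l : Filter ℕ := (hyperfilter ℕ : Filter ℕ) with hl
  have hle : l ≤ atTop := by
    rw [← Nat.cofinite_eq_atTop]; exact hyperfilter_le_cofinite
  let P : ℝ → ℕ → ProbabilityMeasure ℝ := fun t n =>
    ⟨eulerSeq a γ μ₀ n (stepCount n t), isProbabilityMeasure_eulerSeq hγ.le n _⟩
  have hP : ∀ t n, ConvexLE (P t n) μ₀ := fun t n =>
    eulerSeq_convexLE ha₀ ha₁ hγ.le n (Nat.zero_le _)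
  have hPmono : ∀ r t, r ≤ t → ∀ n, ConvexLE (P t n) (P r n) := fun r t hrt n =>
    eulerSeq_convexLE ha₀ ha₁ hγ.le n (stepCount_mono n hrt)
  let T : Set (ProbabilityMeasure ℝ) := {q | ConvexLE q μ₀}
  have hT : IsCompact (closure T) := by
    apply isCompact_closure_of_isTightMeasureSet
    refine (isTightMeasureSet_convexLE (integrable_id_of_rpow hs1 h₀)).subset ?_
    rintro _ ⟨q, hq, rfl⟩
    exact hq
  have hlim : ∀ t, ∃ q : ProbabilityMeasure ℝ, Tendsto (P t) l (𝓝 q) := by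
    intro t
    obtain ⟨q, -, hq⟩ := isCompact_iff_ultrafilter_le_nhds.1 hT ((hyperfilter ℕ).map (P t)) (by
      rw [le_principal_iff]
      exact Filter.mem_map.2 (Eventually.of_forall fun n => subset_closure (hP t n)))
    exact ⟨q, hq⟩
  choose m hm using hlim
  have hcount : ∀ t r, 0 ≤ t → 0 ≤ r →
      Tendsto (fun n => timeStep n * (stepCount n (t + r) - stepCount n t : ℕ)) l (𝓝 r) := by
    intro t r ht hr
    have := ((tendsto_timeStep_mul_stepCount (add_nonneg ht hr)).sub
      (tendsto_timeStep_mul_stepCount ht)).mono_left hle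
    rw [add_sub_cancel_left] at this
    refine this.congr fun n => ?_
    rw [Nat.cast_sub (stepCount_mono n (by linarith))]
    ring
  have hPadd : ∀ t r, 0 ≤ r → ∀ n, (P (t + r) n : Measure ℝ) =
      eulerSeq a γ μ₀ n (stepCount n t + (stepCount n (t + r) - stepCount n t)) := by
    intro t r hr n
    rw [Nat.add_sub_cancel' (stepCount_mono n (by linarith))]
    rfl
  have hint : ∀ (φ : ℝ →ᵇ ℝ) t, Tendsto (fun n => ∫ x, φ x ∂(P t n : Measure ℝ)) l
      (𝓝 (∫ x, φ x ∂(m t : Measure ℝ))) := fun φ t =>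
    ProbabilityMeasure.tendsto_iff_forall_integral_tendsto.1 (hm t) φ
  refine ⟨fun t => m t, ?_, fun t => inferInstance, fun t => ConvexLE.of_tendsto (hm t) (hP t),
    fun r t hrt => moment_le_of_tendsto hs1 h₀ (hm r) (hm t) (hP r) (hPmono r t hrt), ?_, ?_⟩
  · have h0 : ∀ n, P 0 n = ⟨μ₀, inferInstance⟩ := fun n => by
      apply Subtype.ext
      simp [P, stepCount, eulerSeq]
    have := tendsto_nhds_unique (hm 0) (tendsto_const_nhds.congr fun n => (h0 n).symm)
    rw [this]; rfl
  · intro t r ht hr φ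
    refine le_of_tendsto_of_tendsto' ((hint φ (t + r)).sub (hint φ t)).abs
      (((hcount t r ht hr).const_mul (speed s μ₀)).mul_const ‖φ‖) fun n => ?_
    rw [hPadd t r hr]
    exact abs_integral_eulerSeq_sub_le ha₀ ha₁ hγ hs hs1 h₀ n φ _ _
  · intro R hR t r ht hr φ
    have hρ : Tendsto (fun n : ℕ => (n : ℝ) + 1) l atTop :=
      (tendsto_atTop_add_const_right _ _ tendsto_natCast_atTop_atTop).mono_left hle
    have hQ := tendsto_weakQ (a := a) hγ hs hs1 h₀ (hm t) (hP t) hρ φ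
    have hc := hcount t r ht hr
    refine le_of_tendsto_of_tendsto (((hint φ (t + r)).sub (hint φ t)).sub (hc.mul hQ)).abs
      (hc.mul (((hc.const_mul (speed s μ₀)).const_mul (4 * R)).const_add
        (4 * excessInt s R μ₀) |>.const_mul ‖φ‖)) ?_
    filter_upwards [hρ.eventually_ge_atTop R] with n hn
    rw [hPadd t r hr]
    exact abs_integral_eulerSeq_sub_sub_le ha₀ ha₁ hγ hs hs1 h₀ hR hn φ _ _ _ le_rfl

/-! ### The flow is a measure weak solution -/

namespace IsCollisionFlow

variable {a γ s : ℝ} {μ₀ : Measure ℝ} {m : ℝ → Measure ℝ}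

lemma integrable_rpow (h : IsCollisionFlow a γ s μ₀ m) {k : ℝ} (hk : 1 ≤ k)
    (h₀ : Integrable (fun x : ℝ => |x| ^ k) μ₀) (t : ℝ) :
    Integrable (fun x : ℝ => |x| ^ k) (m t) :=
  (h.convexLE t).integrable (convexOn_abs_rpow hk) (fun x => Real.rpow_nonneg (abs_nonneg x) k)
    (continuous_abs_rpow (by linarith)) h₀

lemma abs_integral_sub_le (h : IsCollisionFlow a γ s μ₀ m) {t r : ℝ} (ht : 0 ≤ t) (hr : 0 ≤ r)
    (φ : ℝ →ᵇ ℝ) :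
    |∫ x, φ x ∂(m t) - ∫ x, φ x ∂(m r)| ≤ speed s μ₀ * |t - r| * ‖φ‖ := by
  rcases le_total t r with htr | htr
  · have := h.lipschitz t (r - t) ht (by linarith) φ
    rw [add_sub_cancel] at this
    rwa [abs_sub_comm, abs_sub_comm t, abs_of_nonneg (sub_nonneg.2 htr)]
  · have := h.lipschitz r (t - r) hr (by linarith) φ
    rw [add_sub_cancel] at this
    rwa [abs_of_nonneg (sub_nonneg.2 htr)]

lemma continuousOn_integral (h : IsCollisionFlow a γ s μ₀ m) (φ : ℝ →ᵇ ℝ) :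
    ContinuousOn (fun t => ∫ x, φ x ∂(m t)) (Ici 0) := by
  have : LipschitzOnWith (speed s μ₀ * ‖φ‖).toNNReal (fun t => ∫ x, φ x ∂(m t)) (Ici 0) := by
    refine LipschitzOnWith.of_dist_le_mul fun t ht r hr => ?_
    rw [Real.coe_toNNReal _ (mul_nonneg (speed_nonneg s μ₀) (norm_nonneg φ)), Real.dist_eq,
      Real.dist_eq]
    refine (h.abs_integral_sub_le ht hr φ).trans (le_of_eq (by ring))
  exact this.continuousOn

lemma continuousOn_collisionQ (h : IsCollisionFlow a γ s μ₀ m) (hγ : 0 < γ) (hs : γ ≤ s)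
    (hs1 : 1 ≤ s) [IsProbabilityMeasure μ₀] (h₀ : Integrable (fun x : ℝ => |x| ^ s) μ₀)
    (φ : ℝ →ᵇ ℝ) : ContinuousOn (fun t => collisionQ a γ (m t) (m t) φ) (Ici 0) := by
  intro t ht
  rw [Metric.continuousWithinAt_iff']
  intro ε hε
  have lim : Tendsto (fun R => ‖φ‖ * (4 * excessInt s R μ₀)) atTop (𝓝 0) := by
    simpa using ((tendsto_excessInt (by linarith) h₀).const_mul 4).const_mul ‖φ‖
  obtain ⟨R, hRε, hR⟩ := ((lim.eventually_lt_const (by positivity : (0 : ℝ) < ε / 2)).and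
    (eventually_ge_atTop 1)).exists
  have lim2 : Tendsto (fun r => ‖φ‖ * (4 * R * (speed s μ₀ * |r - t|))) (𝓝[Ici 0] t) (𝓝 0) := by
    have : Continuous fun r => ‖φ‖ * (4 * R * (speed s μ₀ * |r - t|)) := by fun_prop
    simpa using (this.tendsto t).mono_left nhdsWithin_le_nhds
  filter_upwards [lim2.eventually_lt_const (by positivity : (0 : ℝ) < ε / 2),
    self_mem_nhdsWithin] with r hr hr0
  have hp := h.prob
  have key : ∀ u, Integrable (fun p : ℝ × ℝ => |p.1 - p.2| ^ γ) ((m u).prod (m u)) := fun u =>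
    integrable_kernel hγ.le (integrable_abs_rpow_of_le hγ.le hs (h.integrable_rpow hs1 h₀ u))
  have := abs_weakQ_sub_weakQ_le (a := a) hγ hs1 hR h₀ (h.convexLE r) (h.convexLE t) (key r)
    (key t) (abs_kernel_sub_le hγ hs hR) (h.abs_integral_sub_le hr0 ht) φ
  rw [Real.dist_eq, collisionQ_eq_weakQ, collisionQ_eq_weakQ]
  linarith

lemma hasDerivWithinAt (h : IsCollisionFlow a γ s μ₀ m) (hs1 : 1 ≤ s) [IsProbabilityMeasure μ₀]
    (h₀ : Integrable (fun x : ℝ => |x| ^ s) μ₀) (φ : ℝ →ᵇ ℝ) {t : ℝ} (ht : 0 ≤ t) :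
    HasDerivWithinAt (fun t => ∫ x, φ x ∂(m t)) (collisionQ a γ (m t) (m t) φ) (Ioi t) t := by
  rw [hasDerivWithinAt_iff_isLittleO, Asymptotics.isLittleO_iff]
  intro ε hε
  have lim : Tendsto (fun R => ‖φ‖ * (4 * excessInt s R μ₀)) atTop (𝓝 0) := by
    simpa using ((tendsto_excessInt (by linarith) h₀).const_mul 4).const_mul ‖φ‖
  obtain ⟨R, hRε, hR⟩ := ((lim.eventually_lt_const (by positivity : (0 : ℝ) < ε / 2)).and
    (eventually_ge_atTop 1)).exists
  have lim2 : Tendsto (fun r => ‖φ‖ * (4 * R * (speed s μ₀ * (r - t)))) (𝓝[Ioi t] t) (𝓝 0) := by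
    have : Continuous fun r => ‖φ‖ * (4 * R * (speed s μ₀ * (r - t))) := by fun_prop
    simpa using (this.tendsto t).mono_left nhdsWithin_le_nhds
  filter_upwards [lim2.eventually_lt_const (by positivity : (0 : ℝ) < ε / 2),
    self_mem_nhdsWithin] with r hr hrt
  have hrt' : 0 ≤ r - t := sub_nonneg.2 (le_of_lt hrt)
  have := h.expansion R hR t (r - t) ht hrt' φ
  rw [add_sub_cancel] at this
  rw [Real.norm_eq_abs, Real.norm_eq_abs, abs_of_nonneg hrt', smul_eq_mul, mul_comm ε]
  refine this.trans (mul_le_mul_of_nonneg_left ?_ hrt')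
  linarith

lemma integral_id (h : IsCollisionFlow a γ s μ₀ m) (hs1 : 1 ≤ s) [IsProbabilityMeasure μ₀]
    (h₀ : Integrable (fun x : ℝ => |x| ^ s) μ₀) (t : ℝ) : ∫ x, x ∂(m t) = ∫ x, x ∂μ₀ :=
  have := h.prob t
  (h.convexLE t).integral_id_eq (integrable_id_of_rpow hs1 (h.integrable_rpow hs1 h₀ t))
    (integrable_id_of_rpow hs1 h₀)

theorem isMeasureWeakSolution (h : IsCollisionFlow a γ (max γ 2) μ₀ m) (hγ : 0 < γ)
    [IsProbabilityMeasure μ₀] (h₀ : Integrable (fun x : ℝ => |x| ^ (max γ 2)) μ₀) :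
    IsMeasureWeakSolution a γ μ₀ m := by
  have hs : γ ≤ max γ 2 := le_max_left _ _
  have hs1 : 1 ≤ max γ 2 := le_max_of_le_right (by norm_num)
  have hp := h.prob
  have hb₀ := integrable_bracket_rpow (by linarith) h₀
  have hQc := h.continuousOn_collisionQ hγ hs hs1 h₀
  refine ⟨hb₀, fun t _ => integrable_bracket_rpow (by linarith) (h.integrable_rpow hs1 h₀ t),
    fun t _ => ?_, fun t _ => by simp, fun t _ => h.integral_id hs1 h₀ t, hQc,
    fun φ => (hQc φ).locallyIntegrableOn measurableSet_Ici, fun φ t ht => ?_⟩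
  · have hb0 : ∀ x, 0 ≤ bracket x := fun x => zero_le_one.trans (one_le_bracket x)
    exact (h.convexLE t).integral_le (convexOn_rpow_of_nonneg convexOn_bracket hb0 hs1)
      (fun x => Real.rpow_nonneg (hb0 x) _)
      (continuous_bracket.rpow_const fun _ => Or.inr (by linarith)) hb₀
  · have hsub : Icc 0 t ⊆ Ici (0 : ℝ) := fun x hx => hx.1
    have := intervalIntegral.integral_eq_sub_of_hasDeriv_right_of_le ht
      ((h.continuousOn_integral φ).mono hsub)
      (fun x hx => h.hasDerivWithinAt hs1 h₀ φ hx.1.le)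
      (((hQc φ).mono hsub).intervalIntegrable_of_Icc ht)
    rw [this, h.zero]; ring

end IsCollisionFlow

/-! ### Propagation of absolute continuity -/

/-- A one-sided comparison of two finite measures on continuous functions with values in `[0, 1]`
extends to Borel sets, by regularity and Urysohn's lemma. -/
lemma measureReal_le_add_of_forall_integral_le {m₁ m₂ : Measure ℝ} [IsFiniteMeasure m₁]
    [IsFiniteMeasure m₂] {c : ℝ}
    (h : ∀ φ : ℝ →ᵇ ℝ, (∀ x, 0 ≤ φ x) → (∀ x, φ x ≤ 1) → ∫ x, φ x ∂m₁ ≤ ∫ x, φ x ∂m₂ + c)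
    {A : Set ℝ} (hA : MeasurableSet A) : m₁.real A ≤ m₂.real A + c := by
  refine le_of_forall_pos_le_add fun ε hε => ?_
  have hε2 : ENNReal.ofReal (ε / 2) ≠ 0 := by simpa using hε
  obtain ⟨K, hKA, hK, hK1⟩ := hA.exists_isClosed_lt_add (measure_ne_top m₁ A) hε2
  obtain ⟨U, hAU, hU, hU2⟩ := A.exists_isOpen_lt_add (measure_ne_top m₂ A) hε2
  obtain ⟨f, f0, f1, f01⟩ := exists_continuous_zero_one_of_isClosed hU.isClosed_compl hK
    (disjoint_compl_left_iff_subset.2 (hKA.trans hAU))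
  let φ : ℝ →ᵇ ℝ := BoundedContinuousFunction.ofNormedAddCommGroup f f.continuous 1 fun x => by
    rw [Real.norm_of_nonneg (f01 x).1]; exact (f01 x).2
  have hφ := h φ (fun x => (f01 x).1) (fun x => (f01 x).2)
  have a1 : m₁.real A ≤ m₁.real K + ε / 2 := by
    have := ENNReal.toReal_mono (by finiteness) hK1.le
    rwa [ENNReal.toReal_add (by finiteness) (by finiteness),
      ENNReal.toReal_ofReal (by positivity)] at this
  have a2 : m₂.real U ≤ m₂.real A + ε / 2 := by
    have := ENNReal.toReal_mono (by finiteness) hU2.le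
    rwa [ENNReal.toReal_add (by finiteness) (by finiteness),
      ENNReal.toReal_ofReal (by positivity)] at this
  have a3 : m₁.real K ≤ ∫ x, φ x ∂m₁ := by
    rw [← integral_indicator_one hK.measurableSet]
    refine integral_mono ((integrable_const 1).indicator hK.measurableSet) (φ.integrable _)
      fun x => ?_
    by_cases hx : x ∈ K
    · rw [indicator_of_mem hx]; exact (f1 hx).ge
    · rw [indicator_of_notMem hx]; exact (f01 x).1
  have a4 : ∫ x, φ x ∂m₂ ≤ m₂.real U := by
    rw [← integral_indicator_one hU.measurableSet]
    refine integral_mono (φ.integrable _) ((integrable_const 1).indicator hU.measurableSet)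
      fun x => ?_
    by_cases hx : x ∈ U
    · rw [indicator_of_mem hx]; exact (f01 x).2
    · rw [indicator_of_notMem hx]; exact (f0 hx).le
  linarith

/-- The distribution of pairs of independent velocities, weighted by the collision kernel. -/
noncomputable def collisionPairs (γ : ℝ) (μ : Measure ℝ) : Measure (ℝ × ℝ) :=
  (μ.prod μ).withDensity fun p => ENNReal.ofReal (|p.1 - p.2| ^ γ)

lemma isFiniteMeasure_collisionPairs {γ : ℝ} (hγ : 0 ≤ γ) {μ : Measure ℝ} [IsFiniteMeasure μ]
    (h : Integrable (fun x : ℝ => |x| ^ γ) μ) : IsFiniteMeasure (collisionPairs γ μ) :=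
  isFiniteMeasure_withDensity_ofReal (integrable_kernel hγ h).2

lemma integral_map_collisionPairs {γ : ℝ} (hγ : 0 ≤ γ) (μ : Measure ℝ) {g : ℝ × ℝ → ℝ}
    (hg : Measurable g) (φ : ℝ →ᵇ ℝ) :
    ∫ x, φ x ∂((collisionPairs γ μ).map g) =
      ∫ p : ℝ × ℝ, |p.1 - p.2| ^ γ * φ (g p) ∂(μ.prod μ) := by
  rw [integral_map hg.aemeasurable φ.continuous.aestronglyMeasurable, collisionPairs,
    integral_withDensity_eq_integral_toReal_smul
      (continuous_kernel hγ).measurable.ennreal_ofReal (by simp)]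
  simp only [ENNReal.toReal_ofReal (kernel_nonneg γ _), smul_eq_mul]

/-- If the singular part of `μ` is carried by the null set `A`, then collisions do not increase the
mass of `A`: a collision involving a velocity outside `A` almost surely does not end in `A`. -/
lemma map_post_collisionPairs_le {a γ : ℝ} (ha : a ≠ 0) {μ : Measure ℝ} [IsFiniteMeasure μ]
    {A : Set ℝ} (hA : MeasurableSet A) (hA0 : volume A = 0)
    (hac : ∀ N, MeasurableSet N → volume N = 0 → μ (N \ A) = 0) :
    (collisionPairs γ μ).map (post a) A ≤ (collisionPairs γ μ).map Prod.fst A := by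
  rw [Measure.map_apply (continuous_post a).measurable hA, Measure.map_apply measurable_fst hA]
  have hm1 : MeasurableSet (post a ⁻¹' A) := (continuous_post a).measurable hA
  have hm2 : MeasurableSet ((Prod.fst : ℝ × ℝ → ℝ) ⁻¹' A) := measurable_fst hA
  have h0 : (μ.prod μ) (post a ⁻¹' A \ Prod.fst ⁻¹' A) = 0 := by
    rw [Measure.prod_apply_symm (hm1.diff hm2), lintegral_eq_zero_iff' (by
      exact (measurable_measure_prodMk_right (hm1.diff hm2)).aemeasurable)]
    refine Eventually.of_forall fun y => ?_
    have hpre : (fun x : ℝ => (x, y)) ⁻¹' (post a ⁻¹' A \ Prod.fst ⁻¹' A) =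
        ((fun x => a * x) ⁻¹' ((fun x => x + (1 - a) * y) ⁻¹' A)) \ A := rfl
    simp only [Pi.zero_apply]
    rw [hpre]
    refine hac _ (by measurability) ?_
    rw [Real.volume_preimage_mul_left ha, measure_preimage_add_right, hA0, mul_zero]
  have h1 : collisionPairs γ μ (post a ⁻¹' A \ Prod.fst ⁻¹' A) = 0 :=
    withDensity_absolutelyContinuous _ _ h0
  calc collisionPairs γ μ (post a ⁻¹' A)
      ≤ collisionPairs γ μ (post a ⁻¹' A \ Prod.fst ⁻¹' A ∪ Prod.fst ⁻¹' A) :=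
        measure_mono (by rw [sdiff_union_self]; exact subset_union_left)
    _ ≤ _ := (measure_union_le _ _).trans (by rw [h1, zero_add])

namespace IsCollisionFlow

variable {a γ s : ℝ} {μ₀ : Measure ℝ} {m : ℝ → Measure ℝ}

lemma measureReal_le (h : IsCollisionFlow a γ s μ₀ m) {t r : ℝ} (ht : 0 ≤ t) (hr : 0 ≤ r)
    {A : Set ℝ} (hA : MeasurableSet A) :
    (m t).real A ≤ (m r).real A + speed s μ₀ * |t - r| := by
  have hp := h.prob
  refine measureReal_le_add_of_forall_integral_le (fun φ h0 h1 => ?_) hA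
  have hφ : ‖φ‖ ≤ 1 := (BoundedContinuousFunction.norm_le zero_le_one).2 fun x => by
    rw [Real.norm_of_nonneg (h0 x)]; exact h1 x
  have h2 := (le_abs_self _).trans (h.abs_integral_sub_le ht hr φ)
  have h3 : speed s μ₀ * |t - r| * ‖φ‖ ≤ speed s μ₀ * |t - r| * 1 :=
    mul_le_mul_of_nonneg_left hφ (mul_nonneg (speed_nonneg s μ₀) (abs_nonneg _))
  linarith

/-- The null set carrying the singular parts can be chosen independently of time. -/
lemma exists_null_set (h : IsCollisionFlow a γ s μ₀ m) :
    ∃ A : Set ℝ, MeasurableSet A ∧ volume A = 0 ∧ ∀ t, 0 ≤ t → ∀ N, MeasurableSet N →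
      volume N = 0 → m t (N \ A) = 0 := by
  have hp := h.prob
  have hsing : ∀ q : ℚ, ∃ A : Set ℝ, MeasurableSet A ∧ volume A = 0 ∧ ∀ N, MeasurableSet N →
      volume N = 0 → m q (N \ A) = 0 := by
    intro q
    obtain ⟨B, hB, hB0, hB1⟩ := (m q).mutuallySingular_singularPart volume
    refine ⟨Bᶜ, hB.compl, hB1, fun N _ hN => ?_⟩
    have e := congrArg (fun μ : Measure ℝ => μ (N \ Bᶜ))
      ((m q).haveLebesgueDecomposition_add volume)
    simp only [Measure.add_apply] at e
    rw [e, sdiff_compl]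
    refine add_eq_zero.2 ⟨measure_mono_null inter_subset_right hB0, ?_⟩
    exact withDensity_absolutelyContinuous _ _ (measure_mono_null inter_subset_left hN)
  choose A hA hA0 hAN using hsing
  refine ⟨⋃ q, A q, MeasurableSet.iUnion hA, measure_iUnion_null hA0, fun t ht N hN hN0 => ?_⟩
  have hB : MeasurableSet (N \ ⋃ q, A q) := hN.diff (MeasurableSet.iUnion hA)
  rw [← measureReal_eq_zero_iff]
  refine le_antisymm (le_of_forall_pos_le_add fun ε hε => ?_) measureReal_nonneg
  have hL := speed_nonneg s μ₀
  obtain ⟨q, hq1, hq2⟩ := exists_rat_btwn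
    (show t < t + ε / (speed s μ₀ + 1) by linarith [div_pos hε (by linarith : 0 < speed s μ₀ + 1)])
  have h1 := h.measureReal_le ht (ht.trans hq1.le) hB
  have h2 : (m q).real (N \ ⋃ q, A q) = 0 := by
    rw [measureReal_eq_zero_iff]
    exact measure_mono_null (sdiff_subset_sdiff_right (subset_iUnion A q)) (hAN q N hN hN0)
  have h3 : speed s μ₀ * |t - q| ≤ ε := by
    rw [abs_sub_comm, abs_of_pos (by linarith)]
    have h4 : (q : ℝ) - t ≤ ε / (speed s μ₀ + 1) := by linarith
    rw [le_div_iff₀ (by linarith)] at h4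
    nlinarith
  linarith

/-- Over a short time, the mass of the set carrying the singular parts grows at most by the
remainder of the expansion in time. -/
lemma measureReal_add_le (h : IsCollisionFlow a γ s μ₀ m) (ha : a ≠ 0) (hγ : 0 < γ) (hs : γ ≤ s)
    (hs1 : 1 ≤ s) (h₀ : Integrable (fun x : ℝ => |x| ^ s) μ₀) {A : Set ℝ}
    (hA : MeasurableSet A) (hA0 : volume A = 0) {t : ℝ} (ht : 0 ≤ t)
    (hac : ∀ N, MeasurableSet N → volume N = 0 → m t (N \ A) = 0) {R r : ℝ} (hR : 1 ≤ R)
    (hr : 0 ≤ r) :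
    (m (t + r)).real A ≤ (m t).real A + r * (4 * excessInt s R μ₀ + 4 * R * (speed s μ₀ * r)) := by
  have hp := h.prob
  have hγi := integrable_abs_rpow_of_le hγ.le hs (h.integrable_rpow hs1 h₀ t)
  have hfin := isFiniteMeasure_collisionPairs hγ.le hγi
  set gain := (collisionPairs γ (m t)).map (post a)
  set loss := (collisionPairs γ (m t)).map (Prod.fst : ℝ × ℝ → ℝ)
  have hgl : gain A ≤ loss A := map_post_collisionPairs_le ha hA hA0 hac
  have key := measureReal_le_add_of_forall_integral_le (m₁ := m (t + r) + r.toNNReal • loss)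
    (m₂ := m t + r.toNNReal • gain)
    (c := r * (4 * excessInt s R μ₀ + 4 * R * (speed s μ₀ * r))) (fun φ h0 h1 => by
      have hφ : ‖φ‖ ≤ 1 := (BoundedContinuousFunction.norm_le zero_le_one).2 fun x => by
        rw [Real.norm_of_nonneg (h0 x)]; exact h1 x
      have h2 := (le_abs_self _).trans (h.expansion R hR t r ht hr φ)
      have hc : 0 ≤ 4 * excessInt s R μ₀ + 4 * R * (speed s μ₀ * r) := by
        have := excessInt_nonneg s R μ₀
        have := speed_nonneg s μ₀
        positivity
      have h3 : r * (‖φ‖ * (4 * excessInt s R μ₀ + 4 * R * (speed s μ₀ * r))) ≤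
          r * (1 * (4 * excessInt s R μ₀ + 4 * R * (speed s μ₀ * r))) :=
        mul_le_mul_of_nonneg_left (mul_le_mul_of_nonneg_right hφ hc) hr
      rw [integral_add_measure (φ.integrable _) (φ.integrable _),
        integral_add_measure (φ.integrable _) (φ.integrable _), integral_smul_nnreal_measure,
        integral_smul_nnreal_measure, integral_map_collisionPairs hγ.le _ measurable_fst,
        integral_map_collisionPairs hγ.le _ (continuous_post a).measurable]
      rw [collisionQ_eq_weakQ, weakQ_eq_gain_sub_loss a (integrable_kernel hγ.le hγi)
        (fun p => by simp [abs_sub_comm])] at h2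
      simp only [NNReal.smul_def, Real.coe_toNNReal r hr, smul_eq_mul]
      linarith) hA
  have hgl' : gain.real A ≤ loss.real A := ENNReal.toReal_mono (measure_ne_top _ _) hgl
  rw [measureReal_add_apply, measureReal_add_apply, measureReal_nnreal_smul_apply,
    measureReal_nnreal_smul_apply, Real.coe_toNNReal r hr] at key
  have := mul_le_mul_of_nonneg_left hgl' hr
  linarith

/-- The mass of the singular part cannot increase, hence stays zero. -/
theorem absolutelyContinuous (h : IsCollisionFlow a γ s μ₀ m) (ha : a ≠ 0) (hγ : 0 < γ)
    (hs : γ ≤ s) (hs1 : 1 ≤ s) [IsProbabilityMeasure μ₀]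
    (h₀ : Integrable (fun x : ℝ => |x| ^ s) μ₀) (hac : μ₀ ≪ volume) {t : ℝ} (ht : 0 ≤ t) :
    m t ≪ volume := by
  have hp := h.prob
  obtain ⟨A, hA, hA0, hAN⟩ := h.exists_null_set
  have hL := speed_nonneg s μ₀
  have bound : ∀ R, 1 ≤ R → ∀ n : ℕ, (m t).real A ≤
      t * (4 * excessInt s R μ₀ + 4 * R * (speed s μ₀ * (t / (n + 1)))) := by
    intro R hR n
    have hr : 0 ≤ t / (n + 1 : ℝ) := by positivity
    -- subdivide `[0, t]` into `n + 1` intervals; the remainders are of second order in their length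
    have step : ∀ k : ℕ, (m (k * (t / (n + 1)))).real A ≤ k * (t / (n + 1) *
        (4 * excessInt s R μ₀ + 4 * R * (speed s μ₀ * (t / (n + 1))))) := by
      intro k
      induction k with
      | zero => simp [h.zero, measureReal_def, hac hA0]
      | succ k ih =>
        have ht' : 0 ≤ (k : ℝ) * (t / (n + 1)) := by positivity
        have := h.measureReal_add_le ha hγ hs hs1 h₀ hA hA0 ht' (hAN _ ht') hR hr
        rw [show ((k + 1 : ℕ) : ℝ) * (t / (n + 1)) = k * (t / (n + 1)) + t / (n + 1) by
          push_cast; ring]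
        push_cast
        linarith
    have := step (n + 1)
    have e : ((n + 1 : ℕ) : ℝ) * (t / (n + 1)) = t := by push_cast; field_simp
    rw [e, ← mul_assoc, e] at this
    exact this
  have bound2 : ∀ R, 1 ≤ R → (m t).real A ≤ t * (4 * excessInt s R μ₀) := by
    intro R hR
    have lim : Tendsto (fun n : ℕ => t * (4 * excessInt s R μ₀ +
        4 * R * (speed s μ₀ * (t * (1 / ((n : ℝ) + 1)))))) atTop
        (𝓝 (t * (4 * excessInt s R μ₀ + 4 * R * (speed s μ₀ * (t * 0))))) :=
      ((((tendsto_one_div_add_atTop_nhds_zero_nat.const_mul t).const_mul _).const_mul _).const_add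
        _).const_mul t
    have := ge_of_tendsto' lim fun n => by simpa [div_eq_mul_inv] using bound R hR n
    simpa using this
  have hzero : m t A = 0 := by
    rw [← measureReal_eq_zero_iff]
    refine le_antisymm ?_ measureReal_nonneg
    have lim := ((tendsto_excessInt (by linarith) h₀).const_mul 4).const_mul t
    have := ge_of_tendsto lim ((eventually_ge_atTop 1).mono bound2)
    simpa using this
  refine Measure.AbsolutelyContinuous.mk fun N hN hN0 => ?_
  refine measure_mono_null (t := (N \ A) ∪ A) (by rw [sdiff_union_self]; exact subset_union_left) ?_
  exact measure_union_null (hAN t ht N hN hN0) hzero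

/-- The densities of an absolutely continuous flow. -/
theorem exists_density (h : IsCollisionFlow a γ s μ₀ m) (hs1 : 1 ≤ s)
    (h₀ : Integrable (fun x : ℝ => |x| ^ s) μ₀) {t : ℝ} (hac : m t ≪ volume) :
    ∃ f : ℝ → ℝ, (∀ x, 0 ≤ f x) ∧ MemL1 s f ∧
      m t = volume.withDensity fun x => ENNReal.ofReal (f x) := by
  have hp := h.prob
  set g := (m t).rnDeriv volume with hg
  have hgm : Measurable g := Measure.measurable_rnDeriv _ _
  have hlt : ∀ᵐ x, g x < ∞ := (m t).rnDeriv_lt_top volume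
  have hwd : volume.withDensity g = m t := Measure.withDensity_rnDeriv_eq _ _ hac
  refine ⟨fun x => (g x).toReal, fun x => ENNReal.toReal_nonneg,
    ⟨Measure.integrable_toReal_rnDeriv, ?_⟩, ?_⟩
  · have hb := integrable_bracket_rpow (by linarith) (h.integrable_rpow hs1 h₀ t)
    rw [← hwd, integrable_withDensity_iff hgm hlt] at hb
    simpa only [abs_of_nonneg ENNReal.toReal_nonneg] using hb
  · rw [← hwd]
    exact withDensity_congr_ae (hlt.mono fun x hx => (ENNReal.ofReal_toReal hx.ne).symm)

end IsCollisionFlow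

/-! ### Uniqueness under uniform exponential moments -/

lemma excess_le_exp {γ ε R : ℝ} (hγ : 0 ≤ γ) (hε : 0 < ε) (p : ℝ × ℝ) :
    excess γ R p ≤ 2 ^ γ / ε * Real.exp (-(ε / 2 ^ γ * R)) *
      (Real.exp (ε * |p.1| ^ γ) * Real.exp (ε * |p.2| ^ γ)) := by
  have h2 : (0 : ℝ) < 2 ^ γ := by positivity
  set c := ε / (2 : ℝ) ^ γ with hc
  have hc0 : 0 < c := by positivity
  have e1 : (2 : ℝ) ^ γ / ε = 1 / c := by rw [hc, one_div_div]
  rw [e1, ← Real.exp_add, mul_assoc, ← Real.exp_add]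
  refine max_le ?_ (by positivity)
  have h1 := Real.add_one_le_exp (c * (|p.1 - p.2| ^ γ - R))
  have h3 : c * (|p.1 - p.2| ^ γ - R) ≤ -(c * R) + (ε * |p.1| ^ γ + ε * |p.2| ^ γ) := by
    have := mul_le_mul_of_nonneg_left (abs_sub_rpow_le p.1 p.2 hγ) hc0.le
    rw [← mul_assoc, hc, div_mul_cancel₀ _ h2.ne'] at this
    linarith
  have h4 := Real.exp_le_exp.2 h3
  rw [one_div_mul_eq_div, le_div_iff₀ hc0]
  linarith

lemma excessInt_le_exp {γ ε R S : ℝ} (hγ : 0 ≤ γ) (hε : 0 < ε) {μ : Measure ℝ}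
    [IsProbabilityMeasure μ] (hi : Integrable (fun x => Real.exp (ε * |x| ^ γ)) μ)
    (hS : ∫ x, Real.exp (ε * |x| ^ γ) ∂μ ≤ S) :
    excessInt γ R μ ≤ 2 ^ γ / ε * Real.exp (-(ε / 2 ^ γ * R)) * S ^ 2 := by
  have h1 : excessInt γ R μ ≤ ∫ p : ℝ × ℝ, 2 ^ γ / ε * Real.exp (-(ε / 2 ^ γ * R)) *
      (Real.exp (ε * |p.1| ^ γ) * Real.exp (ε * |p.2| ^ γ)) ∂(μ.prod μ) :=
    integral_mono_of_nonneg (Eventually.of_forall (excess_nonneg γ R))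
      ((hi.mul_prod hi).const_mul _) (Eventually.of_forall (excess_le_exp hγ hε))
  rw [integral_const_mul, integral_prod_mul (fun x => Real.exp (ε * |x| ^ γ))
    (fun x => Real.exp (ε * |x| ^ γ)), ← sq] at h1
  refine h1.trans (mul_le_mul_of_nonneg_left ?_ (by positivity))
  exact pow_le_pow_left₀ (integral_nonneg fun x => (Real.exp_pos _).le) hS 2

lemma integrable_rpow_of_exp {γ ε : ℝ} (hε : 0 < ε) {μ : Measure ℝ}
    [IsFiniteMeasure μ] (hγ : 0 < γ) (hi : Integrable (fun x => Real.exp (ε * |x| ^ γ)) μ) {k : ℝ}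
    (hk : 0 ≤ k) : Integrable (fun x : ℝ => |x| ^ k) μ := by
  obtain ⟨n, hn⟩ := exists_nat_ge (k / γ)
  have hkn : k ≤ γ * n := by rwa [div_le_iff₀' hγ] at hn
  refine integrable_abs_rpow_of_le hk hkn ((hi.const_mul (n.factorial / ε ^ n)).mono'
    (continuous_abs_rpow (by positivity)).aestronglyMeasurable (Eventually.of_forall fun x => ?_))
  have h0 : 0 ≤ |x| ^ γ := Real.rpow_nonneg (abs_nonneg x) γ
  rw [Real.norm_of_nonneg (Real.rpow_nonneg (abs_nonneg x) _), Real.rpow_mul (abs_nonneg x),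
    Real.rpow_natCast]
  have := Real.pow_div_factorial_le_exp (ε * |x| ^ γ) (by positivity) n
  rw [div_le_iff₀ (by positivity), mul_pow] at this
  rw [div_mul_eq_mul_div, le_div_iff₀ (by positivity)]
  linarith

lemma abs_collisionQ_sub_le {a γ R d δ : ℝ} (hγ : 0 < γ) (hR : 0 ≤ R) {μ ν : Measure ℝ}
    [IsProbabilityMeasure μ] [IsProbabilityMeasure ν]
    (hμ : Integrable (fun x : ℝ => |x| ^ γ) μ) (hν : Integrable (fun x : ℝ => |x| ^ γ) ν)
    (hδμ : excessInt γ R μ ≤ δ) (hδν : excessInt γ R ν ≤ δ)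
    (hd : ∀ φ : ℝ →ᵇ ℝ, |∫ x, φ x ∂μ - ∫ x, φ x ∂ν| ≤ d * ‖φ‖) (φ : ℝ →ᵇ ℝ) :
    |collisionQ a γ μ μ φ - collisionQ a γ ν ν φ| ≤ ‖φ‖ * (4 * δ + 4 * R * d) := by
  have hcut : ∀ p : ℝ × ℝ, |(|p.1 - p.2| ^ γ) - cutKernel γ R p| ≤ excess γ R p := by
    intro p
    unfold cutKernel excess
    rcases le_total (|p.1 - p.2| ^ γ) R with h | h
    · rw [min_eq_left h, sub_self, abs_zero]; exact le_max_right _ _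
    · rw [min_eq_right h, abs_of_nonneg (sub_nonneg.2 h)]; exact le_max_left _ _
  have err : ∀ (ρ : Measure ℝ) [IsProbabilityMeasure ρ], Integrable (fun x : ℝ => |x| ^ γ) ρ →
      excessInt γ R ρ ≤ δ →
      |collisionQ a γ ρ ρ φ - weakQ a (cutKernel γ R) ρ φ| ≤ 2 * ‖φ‖ * δ := fun ρ _ hi hρ => by
    rw [collisionQ_eq_weakQ]
    exact (abs_weakQ_sub_le (integrable_kernel hγ.le hi) (integrable_cutKernel hγ.le hR _)
      (integrable_excess hγ.le hR hi) hcut φ).trans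
        (mul_le_mul_of_nonneg_left hρ (by positivity))
  have h1 := err μ hμ hδμ
  have h2 := err ν hν hδν
  have h3 := abs_weakQ_cutKernel_sub_le (a := a) hγ.le hR hd φ
  rw [abs_sub_comm] at h2
  have h4 := abs_sub_le (collisionQ a γ μ μ φ) (weakQ a (cutKernel γ R) μ φ) (collisionQ a γ ν ν φ)
  have h5 := abs_sub_le (weakQ a (cutKernel γ R) μ φ) (weakQ a (cutKernel γ R) ν φ)
    (collisionQ a γ ν ν φ)
  linarith

namespace IsMeasureWeakSolution

variable {a γ : ℝ} {μ₀ : Measure ℝ} {μ ν : ℝ → Measure ℝ}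

lemma zero_eq (h : IsMeasureWeakSolution a γ μ₀ μ) [IsFiniteMeasure μ₀] : μ 0 = μ₀ := by
  have : IsFiniteMeasure (μ 0) := by
    have hi := h.mem 0 le_rfl
    refine (integrable_const_iff.1 (?_ : Integrable (fun _ => (1 : ℝ)) (μ 0))).resolve_left
      one_ne_zero
    refine Integrable.mono' hi aestronglyMeasurable_const (Eventually.of_forall fun x => ?_)
    rw [norm_one]
    exact Real.one_le_rpow (one_le_bracket x) (le_max_of_le_right (by norm_num))
  refine ext_of_forall_integral_eq_of_IsFiniteMeasure fun φ => ?_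
  simpa using h.weak_eq φ 0 le_rfl

lemma isProbabilityMeasure (h : IsMeasureWeakSolution a γ μ₀ μ) [IsProbabilityMeasure μ₀] {t : ℝ}
    (ht : 0 ≤ t) : IsProbabilityMeasure (μ t) := by
  rcases ht.eq_or_lt with rfl | ht
  · rw [h.zero_eq]; infer_instance
  · exact ⟨by rw [h.mass t ht, measure_univ]⟩

lemma intervalIntegrable (h : IsMeasureWeakSolution a γ μ₀ μ) (φ : ℝ →ᵇ ℝ) {r t : ℝ} (hr : 0 ≤ r)
    (hrt : r ≤ t) :
    IntervalIntegrable (fun τ => collisionQ a γ (μ τ) (μ τ) φ) volume r t :=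
  ((h.continuousOn φ).mono fun _ hx => hr.trans hx.1).intervalIntegrable_of_Icc hrt

lemma integral_sub_eq (h : IsMeasureWeakSolution a γ μ₀ μ) (φ : ℝ →ᵇ ℝ) {r t : ℝ} (hr : 0 ≤ r)
    (hrt : r ≤ t) : ∫ x, φ x ∂(μ t) - ∫ x, φ x ∂(μ r) =
      ∫ τ in r..t, collisionQ a γ (μ τ) (μ τ) φ := by
  rw [h.weak_eq φ t (hr.trans hrt), h.weak_eq φ r hr,
    ← intervalIntegral.integral_add_adjacent_intervals (h.intervalIntegrable φ le_rfl hr)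
      (h.intervalIntegrable φ hr hrt)]
  ring

/-- Iterating the stability estimate for the kernel truncated at level `R`: the remainder after `n`
iterations is a term of an exponential series, plus the contribution of large velocities, where `δ`
bounds the part of the kernel that is cut off. -/
lemma abs_integral_sub_le_iterate [IsProbabilityMeasure μ₀] (hγ : 0 < γ)
    (hμ : IsMeasureWeakSolution a γ μ₀ μ) (hν : IsMeasureWeakSolution a γ μ₀ ν)
    (hμi : ∀ t, 0 ≤ t → Integrable (fun x : ℝ => |x| ^ γ) (μ t))
    (hνi : ∀ t, 0 ≤ t → Integrable (fun x : ℝ => |x| ^ γ) (ν t)) {R δ : ℝ} (hR : 0 < R)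
    (hδμ : ∀ t, 0 ≤ t → excessInt γ R (μ t) ≤ δ) (hδν : ∀ t, 0 ≤ t → excessInt γ R (ν t) ≤ δ)
    {r : ℝ} (hr : 0 ≤ r) (heq : μ r = ν r) (n : ℕ) {t : ℝ} (ht : r ≤ t) (φ : ℝ →ᵇ ℝ) :
    |∫ x, φ x ∂(μ t) - ∫ x, φ x ∂(ν t)| ≤ (2 * ((4 * R * (t - r)) ^ n / n.factorial) +
      δ / R * (Real.exp (4 * R * (t - r)) - 1)) * ‖φ‖ := by
  have hδ : 0 ≤ δ := (excessInt_nonneg _ _ _).trans (hδμ r hr)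
  induction n generalizing t φ with
  | zero =>
    have := hμ.isProbabilityMeasure (hr.trans ht)
    have := hν.isProbabilityMeasure (hr.trans ht)
    have h1 := φ.norm_integral_le_norm (μ t)
    have h2 := φ.norm_integral_le_norm (ν t)
    rw [Real.norm_eq_abs] at h1 h2
    have h3 := abs_sub (∫ x, φ x ∂(μ t)) (∫ x, φ x ∂(ν t))
    have h4 : 1 ≤ Real.exp (4 * R * (t - r)) := Real.one_le_exp (by
      have := sub_nonneg.2 ht
      positivity)
    have h5 : 0 ≤ δ / R * (Real.exp (4 * R * (t - r)) - 1) * ‖φ‖ :=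
      mul_nonneg (mul_nonneg (by positivity) (by linarith)) (norm_nonneg _)
    simp only [pow_zero, Nat.factorial_zero, Nat.cast_one]
    linarith
  | succ n ih =>
    set G : ℕ → ℝ → ℝ := fun n τ => 2 * ((4 * R * (τ - r)) ^ n / n.factorial) +
      δ / R * (Real.exp (4 * R * (τ - r)) - 1) with hG
    have hderiv : ∀ τ, HasDerivAt (fun τ => G (n + 1) τ * ‖φ‖)
        (‖φ‖ * (4 * δ + 4 * R * G n τ)) τ := by
      intro τ
      have d0 : HasDerivAt (fun τ => 4 * R * (τ - r)) (4 * R) τ := by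
        simpa using ((hasDerivAt_id τ).sub_const r).const_mul (4 * R)
      have d1 := ((d0.pow (n + 1)).div_const ((n + 1).factorial : ℝ)).const_mul 2
      have d2 := ((d0.exp).sub_const 1).const_mul (δ / R)
      refine ((d1.add d2).mul_const ‖φ‖).congr_deriv ?_
      simp only [hG, Nat.add_sub_cancel, Nat.factorial_succ]
      push_cast
      field_simp
      ring
    have hGc : Continuous fun τ => ‖φ‖ * (4 * δ + 4 * R * G n τ) := by
      simp only [hG]; fun_prop
    have hftc := intervalIntegral.integral_eq_sub_of_hasDerivAt (fun τ _ => hderiv τ)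
      (hGc.intervalIntegrable r t)
    -- the right-hand sides form a Picard iteration: `G (n + 1)' = 4 δ + 4 R (G n)`, vanishing at `r`
    have hG0 : G (n + 1) r = 0 := by simp [hG]
    rw [hG0, zero_mul, sub_zero] at hftc
    have e : ∫ x, φ x ∂(μ t) - ∫ x, φ x ∂(ν t) = ∫ τ in r..t,
        (collisionQ a γ (μ τ) (μ τ) φ - collisionQ a γ (ν τ) (ν τ) φ) := by
      rw [intervalIntegral.integral_sub (hμ.intervalIntegrable φ hr ht)
        (hν.intervalIntegrable φ hr ht), ← hμ.integral_sub_eq φ hr ht,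
        ← hν.integral_sub_eq φ hr ht, heq]
      ring
    rw [e, ← hftc, ← Real.norm_eq_abs]
    refine intervalIntegral.norm_integral_le_of_norm_le ht (Eventually.of_forall fun τ hτ => ?_)
      (hGc.intervalIntegrable r t)
    have hτ0 : 0 ≤ τ := hr.trans hτ.1.le
    have := hμ.isProbabilityMeasure hτ0
    have := hν.isProbabilityMeasure hτ0
    exact abs_collisionQ_sub_le hγ hR.le (hμi τ hτ0) (hνi τ hτ0) (hδμ τ hτ0) (hδν τ hτ0)
      (fun ψ => ih hτ.1.le ψ) φ

/-- Two solutions with uniformly bounded exponential moments coincide: over a time span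
proportional to the exponential rate the growth factor `exp (4 R t)` caused by truncating at level
`R` is beaten by the exponential smallness of what is cut off. -/
theorem eq_of_exp_moment [IsProbabilityMeasure μ₀] (hγ : 0 < γ)
    (hμ : IsMeasureWeakSolution a γ μ₀ μ) (hν : IsMeasureWeakSolution a γ μ₀ ν) {ε S : ℝ}
    (hε : 0 < ε)
    (hμi : ∀ t, 0 ≤ t → Integrable (fun x : ℝ => Real.exp (ε * |x| ^ γ)) (μ t))
    (hνi : ∀ t, 0 ≤ t → Integrable (fun x : ℝ => Real.exp (ε * |x| ^ γ)) (ν t))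
    (hμS : ∀ t, 0 ≤ t → ∫ x, Real.exp (ε * |x| ^ γ) ∂(μ t) ≤ S)
    (hνS : ∀ t, 0 ≤ t → ∫ x, Real.exp (ε * |x| ^ γ) ∂(ν t) ≤ S) {t : ℝ} (ht : 0 ≤ t) :
    ν t = μ t := by
  have pμ : ∀ {t}, 0 ≤ t → IsProbabilityMeasure (μ t) := fun ht => hμ.isProbabilityMeasure ht
  have pν : ∀ {t}, 0 ≤ t → IsProbabilityMeasure (ν t) := fun ht => hν.isProbabilityMeasure ht
  set c := ε / (2 : ℝ) ^ γ with hc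
  have hc0 : 0 < c := by positivity
  set D := 2 ^ γ / ε * S ^ 2 with hD
  have hD0 : 0 ≤ D := by positivity
  have mγ : ∀ (ρ : Measure ℝ) [IsProbabilityMeasure ρ],
      Integrable (fun x : ℝ => Real.exp (ε * |x| ^ γ)) ρ →
      Integrable (fun x : ℝ => |x| ^ γ) ρ := fun ρ _ hi => integrable_rpow_of_exp hε hγ hi hγ.le
  have short : ∀ r, 0 ≤ r → μ r = ν r → ∀ t, r ≤ t → t ≤ r + c / 8 → μ t = ν t := by
    intro r hr heq t hrt htc
    have ht0 := hr.trans hrt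
    have := pμ ht0
    have := pν ht0
    refine ext_of_forall_integral_eq_of_IsFiniteMeasure fun φ => ?_
    have bound : ∀ R, 1 ≤ R → |∫ x, φ x ∂(μ t) - ∫ x, φ x ∂(ν t)| ≤
        D * Real.exp (-(c / 2 * R)) * ‖φ‖ := by
      intro R hR
      have hδ : ∀ (ρ : Measure ℝ) [IsProbabilityMeasure ρ],
          Integrable (fun x : ℝ => Real.exp (ε * |x| ^ γ)) ρ →
          ∫ x, Real.exp (ε * |x| ^ γ) ∂ρ ≤ S →
          excessInt γ R ρ ≤ D * Real.exp (-(c * R)) := fun ρ _ hi hS =>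
        (excessInt_le_exp hγ.le hε hi hS).trans (le_of_eq (by rw [hD]; ring))
      have iter := fun n => abs_integral_sub_le_iterate hγ hμ hν
        (fun t ht => have := pμ ht; mγ _ (hμi t ht)) (fun t ht => have := pν ht; mγ _ (hνi t ht))
        (by linarith : 0 < R)
        (fun t ht => have := pμ ht; hδ _ (hμi t ht) (hμS t ht))
        (fun t ht => have := pν ht; hδ _ (hνi t ht) (hνS t ht)) hr heq n hrt φ
      have lim := (((FloorSemiring.tendsto_pow_div_factorial_atTop
        (4 * R * (t - r))).const_mul 2).add_const (D * Real.exp (-(c * R)) / R *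
          (Real.exp (4 * R * (t - r)) - 1))).mul_const ‖φ‖
      rw [mul_zero, zero_add] at lim
      refine (ge_of_tendsto' lim iter).trans (mul_le_mul_of_nonneg_right ?_ (norm_nonneg _))
      have h1 : Real.exp (4 * R * (t - r)) - 1 ≤ Real.exp (c / 2 * R) := by
        have : Real.exp (4 * R * (t - r)) ≤ Real.exp (c / 2 * R) := Real.exp_le_exp.2 (by
          nlinarith)
        linarith
      have h2 : D * Real.exp (-(c * R)) / R ≤ D * Real.exp (-(c * R)) :=
        div_le_self (by positivity) hR
      calc _ ≤ D * Real.exp (-(c * R)) / R * Real.exp (c / 2 * R) :=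
            mul_le_mul_of_nonneg_left h1 (by positivity)
        _ ≤ D * Real.exp (-(c * R)) * Real.exp (c / 2 * R) :=
            mul_le_mul_of_nonneg_right h2 (Real.exp_pos _).le
        _ = D * Real.exp (-(c / 2 * R)) := by
            rw [mul_assoc, ← Real.exp_add]; congr 2; ring
    have lim : Tendsto (fun R => D * Real.exp (-(c / 2 * R)) * ‖φ‖) atTop (𝓝 (D * 0 * ‖φ‖)) :=
      ((Real.tendsto_exp_neg_atTop_nhds_zero.comp
        (tendsto_id.const_mul_atTop (by positivity : 0 < c / 2))).const_mul D).mul_const _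
    have := ge_of_tendsto lim ((eventually_ge_atTop 1).mono bound)
    rw [mul_zero, zero_mul] at this
    exact sub_eq_zero.1 (abs_eq_zero.1 (le_antisymm this (abs_nonneg _)))
  have global : ∀ n : ℕ, ∀ t, 0 ≤ t → t ≤ n * (c / 8) → μ t = ν t := by
    intro n
    induction n with
    | zero =>
      intro t ht0 ht1
      have : t = 0 := le_antisymm (by simpa using ht1) ht0
      rw [this, hμ.zero_eq, hν.zero_eq]
    | succ n ih =>
      intro t ht0 ht1
      push_cast at ht1
      rcases le_total t (n * (c / 8)) with h | h
      · exact ih t ht0 h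
      · exact short _ (by positivity) (ih _ (by positivity) le_rfl) t h (by linarith)
  obtain ⟨n, hn⟩ := exists_nat_ge (t / (c / 8))
  exact (global n t ht ((div_le_iff₀ (by positivity)).1 hn)).symm

end IsMeasureWeakSolution

/-! ### A Baire category argument -/

/-- Let `M` be finite and lower semicontinuous on `[0, ∞)` and suppose that each `H i` decreases on
intervals where `M` is bounded, while `M` decreases as soon as all `H i` do. Then the `H i` decrease
everywhere. By Baire's theorem, on the closed set of times near which `M` is unbounded there would
be a relatively open piece on which `M` is bounded; on the gaps of that piece `M` decreases, so that
`M` would be bounded near the piece after all. -/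
lemma antitone_of_locally_bounded {ι : Type*} {H : ι → ℝ → ℝ} {M : ℝ → ℝ≥0∞}
    (hH : ∀ i, ContinuousOn (H i) (Ici 0)) (hfin : ∀ t, 0 ≤ t → M t ≠ ∞)
    (hlsc : ∀ K : ℕ, IsClosed {t : ℝ | 0 ≤ t ∧ M t ≤ K})
    (hM : ∀ r t, 0 ≤ r → r ≤ t → (∀ i, H i t ≤ H i r) → M t ≤ M r)
    (hloc : ∀ (K : ℕ) (r t : ℝ), 0 ≤ r → r ≤ t → (∀ τ ∈ Icc r t, M τ ≤ K) →
      ∀ i, H i t ≤ H i r) {r t : ℝ} (hr : 0 ≤ r) (hrt : r ≤ t) (i : ι) : H i t ≤ H i r := by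
  set Good : ℝ → Prop := fun t => ∃ δ > 0, ∃ K : ℕ, ∀ τ, |τ - t| < δ → 0 ≤ τ → M τ ≤ K with hGood
  set F : Set ℝ := {t | 0 ≤ t ∧ ¬ Good t} with hF
  have hnat : ∀ x : ℝ≥0∞, x ≠ ∞ → ∃ K : ℕ, x ≤ K := fun x hx =>
    (ENNReal.exists_nat_gt hx).imp fun _ h => h.le
  have hopen : IsOpen {t | Good t} := by
    refine Metric.isOpen_iff.2 fun t ht => ?_
    obtain ⟨δ, hδ, K, hK⟩ := ht
    refine ⟨δ / 2, by positivity, fun u hu => ⟨δ / 2, by positivity, K, fun τ hτ hτ0 => ?_⟩⟩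
    rw [Metric.mem_ball, Real.dist_eq] at hu
    exact hK τ (by linarith [abs_sub_le τ u t]) hτ0
  have hFc : IsClosed F := isClosed_Ici.inter hopen.isClosed_compl
  -- away from `F` the quantity `M` is bounded on compact intervals
  have gap : ∀ r t, 0 ≤ r → r ≤ t → (∀ τ ∈ Icc r t, τ ∉ F) → ∀ i, H i t ≤ H i r := by
    intro r t hr hrt hdisj
    obtain ⟨K, hK⟩ : ∃ K : ℕ, ∀ τ ∈ Icc r t, 0 ≤ τ → M τ ≤ K := by
      refine isCompact_Icc.induction_on (p := fun S => ∃ K : ℕ, ∀ τ ∈ S, 0 ≤ τ → M τ ≤ K)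
        ⟨0, by simp⟩ (fun S T hST ⟨K, hK⟩ => ⟨K, fun τ hτ => hK τ (hST hτ)⟩) ?_ ?_
      · rintro S T ⟨K, hK⟩ ⟨L, hL⟩
        refine ⟨max K L, fun τ hτ hτ0 => ?_⟩
        rcases hτ with hτ | hτ
        · exact (hK τ hτ hτ0).trans (by exact_mod_cast le_max_left K L)
        · exact (hL τ hτ hτ0).trans (by exact_mod_cast le_max_right K L)
      · intro τ hτ
        have : Good τ := by
          by_contra hg
          exact hdisj τ hτ ⟨hr.trans hτ.1, hg⟩
        obtain ⟨δ, hδ, K, hK⟩ := this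
        exact ⟨Metric.ball τ δ, mem_nhdsWithin_of_mem_nhds (Metric.ball_mem_nhds τ hδ), K,
          fun u hu => hK u hu⟩
    exact hloc K r t hr hrt fun τ hτ => hK τ hτ (hr.trans hτ.1)
  by_cases hne : F.Nonempty
  swap
  · exact gap r t hr hrt (fun τ _ hτ => hne ⟨τ, hτ⟩) i
  exfalso
  have : CompleteSpace F := hFc.completeSpace_coe
  have : Nonempty F := hne.to_subtype
  obtain ⟨K, ⟨σ, hσF⟩, hσ⟩ := nonempty_interior_of_iUnion_of_closed
    (f := fun K : ℕ => {x : F | M x ≤ K}) (fun K => by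
      have := (hlsc K).preimage (continuous_subtype_val (p := fun x => x ∈ F))
      convert this using 1
      ext x
      exact ⟨fun hx => ⟨x.2.1, hx⟩, fun hx => hx.2⟩)
    (eq_univ_of_forall fun x => mem_iUnion.2 (hnat _ (hfin x x.2.1)))
  rw [mem_interior_iff_mem_nhds, Metric.mem_nhds_iff] at hσ
  obtain ⟨δ, hδ, hball⟩ := hσ
  have hK : ∀ τ ∈ F, |τ - σ| < δ → M τ ≤ K := fun τ hτ hd =>
    hball (show (⟨τ, hτ⟩ : F) ∈ Metric.ball ⟨σ, hσF⟩ δ from hd)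
  set c := max (σ - δ / 2) 0 with hc
  have hc0 : 0 ≤ c := le_max_right _ _
  have hcσ : c ≤ σ := max_le (by linarith) hσF.1
  obtain ⟨L, hL⟩ := hnat _ (hfin c hc0)
  refine hσF.2 ⟨δ / 2, by positivity, max K L, fun τ hτ hτ0 => ?_⟩
  have hτ' := abs_lt.1 hτ
  have hcτ : c ≤ τ := max_le (by linarith) hτ0
  by_cases hinter : (F ∩ Icc c τ).Nonempty
  · -- go back to the last time `α` in `F` before `τ`
    obtain ⟨α, ⟨hαF, hαI⟩, hαmax⟩ := (isCompact_Icc.inter_left hFc).exists_isGreatest hinter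
    have hMα : M α ≤ K := hK α hαF (by
      have := le_max_left (σ - δ / 2) 0
      rw [abs_lt]; constructor <;> linarith [hαI.1, hαI.2])
    have hα0 : 0 ≤ α := hαF.1
    have hMτ : M τ ≤ M α := by
      refine hM α τ hα0 hαI.2 fun i => ?_
      rcases hαI.2.eq_or_lt with h | hατ
      · rw [h]
      have lim : Tendsto (H i) (𝓝[>] α) (𝓝 (H i α)) :=
        (hH i α hα0).mono_left (nhdsWithin_mono _ fun x hx => hα0.trans (le_of_lt hx))
      refine ge_of_tendsto lim ?_
      filter_upwards [Ioo_mem_nhdsGT hατ] with η hη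
      refine gap η τ (hα0.trans hη.1.le) hη.2.le (fun u hu huF => ?_) i
      exact absurd (hαmax ⟨huF, hαI.1.trans (hη.1.le.trans hu.1), hu.2⟩) (by
        have := hη.1.trans_le hu.1
        exact not_le.2 this)
    exact (hMτ.trans hMα).trans (by exact_mod_cast le_max_left K L)
  · have := hM c τ hc0 hcτ (gap c τ hc0 hcτ fun u hu huF => hinter ⟨u, huF, hu⟩)
    exact (this.trans hL).trans (by exact_mod_cast le_max_right K L)

/-! ### Moments of arbitrary measure weak solutions -/

/-- The convex function `(|x| - r)₊`. -/
def tail (r x : ℝ) : ℝ := max (|x| - r) 0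

lemma continuous_tail (r : ℝ) : Continuous (tail r) := by unfold tail; fun_prop

lemma tail_nonneg (r x : ℝ) : 0 ≤ tail r x := le_max_right _ _

lemma tail_le_abs {r : ℝ} (hr : 0 ≤ r) (x : ℝ) : tail r x ≤ |x| :=
  max_le (by linarith) (abs_nonneg x)

lemma convexOn_tail (r : ℝ) : ConvexOn ℝ univ (tail r) :=
  ConvexOn.sup (convexOn_abs_univ.add_const (-r)) (convexOn_const _ convex_univ)

lemma lintegral_tail_mul_rpow {p : ℝ} (hp : 1 < p) {u : ℝ} (hu : 0 ≤ u) :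
    ∫⁻ r in Ioi (0 : ℝ), ENNReal.ofReal (max (u - r) 0) *
      ENNReal.ofReal (p * (p - 1) * r ^ (p - 2)) = ENNReal.ofReal (u ^ p) := by
  have hsplit : Ioi (0 : ℝ) = Ioc 0 u ∪ Ioi u := (Ioc_union_Ioi_eq_Ioi hu).symm
  rw [hsplit, lintegral_union measurableSet_Ioi (Ioc_disjoint_Ioi le_rfl)]
  have h2 : ∫⁻ r in Ioi u, ENNReal.ofReal (max (u - r) 0) *
      ENNReal.ofReal (p * (p - 1) * r ^ (p - 2)) = 0 := by
    rw [setLIntegral_congr_fun (g := fun _ => 0) measurableSet_Ioi (fun r hr => by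
      have : u - r ≤ 0 := sub_nonpos.2 (le_of_lt hr)
      simp [max_eq_right this])]
    simp
  have i1 : IntervalIntegrable (fun r : ℝ => u * (p * (p - 1)) * r ^ (p - 2)) volume 0 u :=
    (intervalIntegral.intervalIntegrable_rpow' (by linarith)).const_mul _
  have i2 : IntervalIntegrable (fun r : ℝ => p * (p - 1) * r ^ (p - 1)) volume 0 u :=
    (intervalIntegral.intervalIntegrable_rpow' (by linarith)).const_mul _
  have h1 : ∫⁻ r in Ioc 0 u, ENNReal.ofReal (max (u - r) 0) *
      ENNReal.ofReal (p * (p - 1) * r ^ (p - 2)) =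
      ∫⁻ r in Ioc 0 u, ENNReal.ofReal
        (u * (p * (p - 1)) * r ^ (p - 2) - p * (p - 1) * r ^ (p - 1)) := by
    refine setLIntegral_congr_fun measurableSet_Ioc fun r hr => ?_
    have hru : 0 ≤ u - r := sub_nonneg.2 hr.2
    rw [max_eq_left hru, ← ENNReal.ofReal_mul hru]
    congr 1
    have : r ^ (p - 1) = r ^ (p - 2) * r := by
      rw [← Real.rpow_add_one hr.1.ne']; congr 1; ring
    rw [this]; ring
  rw [h2, add_zero, h1, ← ofReal_integral_eq_lintegral_ofReal]
  · rw [← intervalIntegral.integral_of_le hu, intervalIntegral.integral_sub i1 i2,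
      intervalIntegral.integral_const_mul, intervalIntegral.integral_const_mul,
      integral_rpow (Or.inl (by linarith)), integral_rpow (Or.inl (by linarith))]
    congr 1
    have e1 : p - 2 + 1 = p - 1 := by ring
    have e2 : p - 1 + 1 = p := by ring
    have hp1 : p - 1 ≠ 0 := by linarith
    have hp0 : p ≠ 0 := by linarith
    rw [e1, e2, Real.zero_rpow hp1, Real.zero_rpow hp0, sub_zero, sub_zero]
    have : u ^ p = u ^ (p - 1) * u := by
      rcases hu.eq_or_lt with rfl | hu
      · rw [Real.zero_rpow hp0, mul_zero]
      · rw [← Real.rpow_add_one hu.ne']; congr 1; ring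
    rw [this]
    field_simp
    ring
  · exact ((intervalIntegrable_iff_integrableOn_Ioc_of_le hu).1 i1).sub
      ((intervalIntegrable_iff_integrableOn_Ioc_of_le hu).1 i2)
  · refine (ae_restrict_iff' measurableSet_Ioc).2 (Eventually.of_forall fun r hr => ?_)
    have : r ^ (p - 1) = r ^ (p - 2) * r := by
      rw [← Real.rpow_add_one hr.1.ne']; congr 1; ring
    simp only [Pi.zero_apply]
    rw [this]
    have h3 : 0 ≤ p * (p - 1) * r ^ (p - 2) * (u - r) :=
      mul_nonneg (mul_nonneg (mul_nonneg (by linarith) (by linarith))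
        (Real.rpow_nonneg hr.1.le _)) (sub_nonneg.2 hr.2)
    linarith

/-- Powers of order `p > 1` are superpositions of the functions `(|x| - r)₊`, so comparing the
latter compares all moments. -/
lemma lintegral_rpow_le_of_tail_le {μ ν : Measure ℝ} [SFinite μ] [SFinite ν]
    (hμ : Integrable (fun x : ℝ => x) μ) (hν : Integrable (fun x : ℝ => x) ν)
    (h : ∀ r, 0 ≤ r → ∫ x, tail r x ∂μ ≤ ∫ x, tail r x ∂ν) {p : ℝ} (hp : 1 ≤ p) :
    ∫⁻ x, ENNReal.ofReal (|x| ^ p) ∂μ ≤ ∫⁻ x, ENNReal.ofReal (|x| ^ p) ∂ν := by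
  have ti : ∀ (ρ : Measure ℝ), Integrable (fun x : ℝ => x) ρ → ∀ r, 0 ≤ r →
      Integrable (tail r) ρ := fun ρ hρ r hr =>
    hρ.abs.mono' (continuous_tail r).aestronglyMeasurable (Eventually.of_forall fun x => by
      rw [Real.norm_of_nonneg (tail_nonneg r x)]; exact tail_le_abs hr x)
  have ht : ∀ r, 0 ≤ r → ∫⁻ x, ENNReal.ofReal (tail r x) ∂μ ≤
      ∫⁻ x, ENNReal.ofReal (tail r x) ∂ν := fun r hr => by
    rw [← ofReal_integral_eq_lintegral_ofReal (ti μ hμ r hr) (Eventually.of_forall (tail_nonneg r)),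
      ← ofReal_integral_eq_lintegral_ofReal (ti ν hν r hr) (Eventually.of_forall (tail_nonneg r))]
    exact ENNReal.ofReal_le_ofReal (h r hr)
  rcases hp.eq_or_lt with rfl | hp
  · simpa [tail] using ht 0 le_rfl
  have rep : ∀ (ρ : Measure ℝ) [SFinite ρ], ∫⁻ x, ENNReal.ofReal (|x| ^ p) ∂ρ =
      ∫⁻ r in Ioi (0 : ℝ), (∫⁻ x, ENNReal.ofReal (tail r x) ∂ρ) *
        ENNReal.ofReal (p * (p - 1) * r ^ (p - 2)) := by
    intro ρ _
    have hmr : Measurable fun r : ℝ => ENNReal.ofReal (p * (p - 1) * r ^ (p - 2)) := by fun_prop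
    calc ∫⁻ x, ENNReal.ofReal (|x| ^ p) ∂ρ
        = ∫⁻ x, (∫⁻ r in Ioi (0 : ℝ), ENNReal.ofReal (tail r x) *
            ENNReal.ofReal (p * (p - 1) * r ^ (p - 2))) ∂ρ :=
          lintegral_congr fun x => (lintegral_tail_mul_rpow hp (abs_nonneg x)).symm
      _ = ∫⁻ r in Ioi (0 : ℝ), ∫⁻ x, ENNReal.ofReal (tail r x) *
            ENNReal.ofReal (p * (p - 1) * r ^ (p - 2)) ∂ρ := by
          refine lintegral_lintegral_swap (Measurable.aemeasurable ?_)
          refine Measurable.mul ?_ (hmr.comp measurable_snd)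
          unfold tail
          exact (by fun_prop : Continuous fun q : ℝ × ℝ =>
            max (|q.1| - q.2) 0).measurable.ennreal_ofReal
      _ = _ := lintegral_congr fun r =>
          lintegral_mul_const _ (continuous_tail r).measurable.ennreal_ofReal
  rw [rep μ, rep ν]
  refine setLIntegral_mono' measurableSet_Ioi fun r hr => ?_
  exact mul_le_mul_left (ht r (le_of_lt hr)) _

/-- Comparison of all moments of order at least `1` yields comparison of exponential moments, term
by term in the exponential series; the terms of order below `1` are controlled by the first
moment. -/
lemma lintegral_exp_le_of_moments_le {μ ν : Measure ℝ} [IsProbabilityMeasure μ] {γ ε : ℝ}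
    (hγ : 0 ≤ γ) (hε : 0 ≤ ε)
    (h : ∀ p : ℝ, 1 ≤ p → ∫⁻ x, ENNReal.ofReal (|x| ^ p) ∂μ ≤ ∫⁻ x, ENNReal.ofReal (|x| ^ p) ∂ν) :
    ∫⁻ x, ENNReal.ofReal (Real.exp (ε * |x| ^ γ)) ∂μ ≤
      ∫⁻ x, ENNReal.ofReal (Real.exp (ε * |x| ^ γ)) ∂ν +
        ENNReal.ofReal (Real.exp ε) * (1 + ∫⁻ x, ENNReal.ofReal |x| ∂ν) := by
  have series : ∀ u : ℝ, 0 ≤ u → ENNReal.ofReal (Real.exp u) =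
      ∑' k : ℕ, ENNReal.ofReal (u ^ k / k.factorial) := fun u hu => by
    rw [Real.exp_eq_exp_ℝ, NormedSpace.exp_eq_tsum_div]
    exact ENNReal.ofReal_tsum_of_nonneg (fun k => by positivity) (Real.summable_pow_div_factorial u)
  have n0 : ∀ x : ℝ, 0 ≤ |x| ^ γ := fun x => Real.rpow_nonneg (abs_nonneg x) γ
  have term : ∀ (k : ℕ) (x : ℝ), ENNReal.ofReal ((ε * |x| ^ γ) ^ k / k.factorial) =
      ENNReal.ofReal (ε ^ k / k.factorial) * ENNReal.ofReal (|x| ^ (γ * k)) := fun k x => by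
    rw [← ENNReal.ofReal_mul (by positivity), Real.rpow_mul (abs_nonneg x), Real.rpow_natCast]
    congr 1; ring
  have hmeas : ∀ q : ℝ, Measurable fun x : ℝ => ENNReal.ofReal (|x| ^ q) := fun q => by fun_prop
  have rep : ∀ ρ : Measure ℝ, ∫⁻ x, ENNReal.ofReal (Real.exp (ε * |x| ^ γ)) ∂ρ =
      ∑' k : ℕ, ENNReal.ofReal (ε ^ k / k.factorial) *
        ∫⁻ x, ENNReal.ofReal (|x| ^ (γ * k)) ∂ρ := fun ρ => by
    simp_rw [series _ (mul_nonneg hε (n0 _)), term]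
    rw [lintegral_tsum fun k => ((hmeas _).const_mul _).aemeasurable]
    exact tsum_congr fun k => lintegral_const_mul _ (hmeas _)
  have hk : ∀ k : ℕ, ∫⁻ x, ENNReal.ofReal (|x| ^ (γ * k)) ∂μ ≤
      ∫⁻ x, ENNReal.ofReal (|x| ^ (γ * k)) ∂ν + (1 + ∫⁻ x, ENNReal.ofReal |x| ∂ν) := by
    intro k
    rcases le_total 1 (γ * k) with h1 | h1
    · exact (h _ h1).trans le_self_add
    · refine le_trans ?_ le_add_self
      have h2 := h 1 le_rfl
      simp only [Real.rpow_one] at h2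
      refine le_trans ?_ (add_le_add_right h2 1)
      rw [← measure_univ (μ := μ), ← lintegral_one, ← lintegral_add_left measurable_const]
      refine lintegral_mono fun x => ?_
      rw [← ENNReal.ofReal_one, ← ENNReal.ofReal_add zero_le_one (abs_nonneg x)]
      refine ENNReal.ofReal_le_ofReal ?_
      simpa using rpow_le_one_add_rpow (abs_nonneg x) (by positivity : 0 ≤ γ * k) h1
  rw [rep μ, rep ν, series ε hε, ← ENNReal.tsum_mul_right, ← ENNReal.tsum_add]
  refine ENNReal.tsum_le_tsum fun k => ?_
  rw [← mul_add]
  gcongr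
  exact hk k

lemma abs_collisionDelta_le_of_le_abs {a : ℝ} (ha₀ : 0 < a) (ha₁ : a < 1) {φ : ℝ → ℝ}
    (h : ∀ x, |φ x| ≤ |x|) (x y : ℝ) : |collisionDelta a φ x y| ≤ 3 * (|x| + |y|) := by
  have conv : ∀ u v : ℝ, |a * u + (1 - a) * v| ≤ |u| + |v| := fun u v => by
    refine (abs_add_le _ _).trans ?_
    rw [abs_mul, abs_mul, abs_of_pos ha₀, abs_of_pos (sub_pos.2 ha₁)]
    nlinarith [abs_nonneg u, abs_nonneg v]
  have h1 := (h (a * x + (1 - a) * y)).trans (conv x y)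
  have h2 := (h ((1 - a) * x + a * y)).trans
    ((congrArg _ (add_comm _ _)).trans_le (conv y x))
  have h3 := h x
  have h4 := h y
  rw [abs_le] at h1 h2 h3 h4
  unfold collisionDelta
  rw [abs_le]; constructor <;> linarith [h1.1, h1.2, h2.1, h2.2, h3.1, h3.2, h4.1, h4.2]

lemma kernel_mul_add_le (x y : ℝ) {γ : ℝ} (hγ : 0 ≤ γ) :
    |x - y| ^ γ * (|x| + |y|) ≤ 2 ^ (1 + γ) * (|x| ^ (1 + γ) + |y| ^ (1 + γ)) := by
  have hxy : 0 ≤ |x| + |y| := by positivity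
  calc |x - y| ^ γ * (|x| + |y|) ≤ (|x| + |y|) ^ γ * (|x| + |y|) :=
        mul_le_mul_of_nonneg_right (Real.rpow_le_rpow (abs_nonneg _) (abs_sub x y) hγ) hxy
    _ = (|x| + |y|) ^ (1 + γ) := by
        rw [Real.rpow_add' hxy (by linarith), Real.rpow_one, mul_comm]
    _ ≤ _ := rpow_add_le (abs_nonneg x) (abs_nonneg y) (by linarith)

lemma collisionDelta_nonpos {a : ℝ} (ha₀ : 0 < a) (ha₁ : a < 1) {φ : ℝ → ℝ}
    (hφ : ConvexOn ℝ univ φ) (x y : ℝ) : collisionDelta a φ x y ≤ 0 := by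
  have e1 := hφ.2 (mem_univ x) (mem_univ y) ha₀.le (sub_pos.2 ha₁).le (by ring)
  have e2 := hφ.2 (mem_univ y) (mem_univ x) ha₀.le (sub_pos.2 ha₁).le (by ring)
  simp only [smul_eq_mul] at e1 e2
  unfold collisionDelta
  rw [add_comm ((1 - a) * x)]
  linarith

/-- The function `(|x| - r)₊` truncated at height `n`. -/
noncomputable def cutTail (r : ℝ) (n : ℕ) : ℝ →ᵇ ℝ :=
  BoundedContinuousFunction.ofNormedAddCommGroup (fun x => min (tail r x) n)
    ((continuous_tail r).min continuous_const) n fun x => by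
      rw [Real.norm_of_nonneg (le_min (tail_nonneg r x) n.cast_nonneg)]; exact min_le_right _ _

lemma cutTail_apply (r : ℝ) (n : ℕ) (x : ℝ) : cutTail r n x = min (tail r x) n := rfl

lemma abs_cutTail_le {r : ℝ} (hr : 0 ≤ r) (n : ℕ) (x : ℝ) : |cutTail r n x| ≤ |x| := by
  rw [cutTail_apply, abs_of_nonneg (le_min (tail_nonneg r x) n.cast_nonneg)]
  exact (min_le_left _ _).trans (tail_le_abs hr x)

lemma tendsto_cutTail (r x : ℝ) : Tendsto (fun n => cutTail r n x) atTop (𝓝 (tail r x)) := by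
  refine tendsto_const_nhds.congr' ?_
  filter_upwards [eventually_ge_atTop ⌈tail r x⌉₊] with n hn
  exact (min_eq_left ((Nat.le_ceil _).trans (by exact_mod_cast hn))).symm

lemma tail_sub_cutTail_le {r : ℝ} (hr : 0 ≤ r) (n : ℕ) (x : ℝ) :
    |tail r x - cutTail r n x| ≤ (1 / ((n : ℝ) + 1)) * (2 * (1 + x ^ 2)) := by
  rw [cutTail_apply, abs_of_nonneg (sub_nonneg.2 (min_le_left _ _)), one_div_mul_eq_div,
    le_div_iff₀ (by positivity)]
  have h1 := tail_le_abs hr x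
  have h2 := sq_abs x
  rcases le_total (tail r x) n with h | h
  · rw [min_eq_left h, sub_self, zero_mul]; positivity
  · rw [min_eq_right h]
    have h3 : (0 : ℝ) ≤ n := n.cast_nonneg
    nlinarith [sq_nonneg (|x| - 1), abs_nonneg x]

namespace IsMeasureWeakSolution

variable {a γ : ℝ} {μ₀ : Measure ℝ} {ν : ℝ → Measure ℝ}

lemma integrable_rpow (h : IsMeasureWeakSolution a γ μ₀ ν) {t : ℝ} (ht : 0 ≤ t) :
    Integrable (fun x : ℝ => |x| ^ (max γ 2)) (ν t) := by
  have hs : 0 ≤ max γ 2 := le_max_of_le_right (by norm_num)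
  refine Integrable.mono' (h.mem t ht) (continuous_abs_rpow hs).aestronglyMeasurable
    (Eventually.of_forall fun x => ?_)
  rw [Real.norm_of_nonneg (Real.rpow_nonneg (abs_nonneg x) _)]
  exact Real.rpow_le_rpow (abs_nonneg x) (abs_le_bracket x) hs

lemma one_add_sq_le (γ x : ℝ) : 1 + x ^ 2 ≤ bracket x ^ (max γ 2) := by
  calc 1 + x ^ 2 = bracket x ^ (2 : ℝ) := by
        rw [Real.rpow_two, bracket, Real.sq_sqrt (by positivity), sq_abs]
    _ ≤ _ := Real.rpow_le_rpow_of_exponent_le (one_le_bracket x) (le_max_right _ _)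

lemma integrable_one_add_sq (h : IsMeasureWeakSolution a γ μ₀ ν) {t : ℝ} (ht : 0 ≤ t) :
    Integrable (fun x : ℝ => 1 + x ^ 2) (ν t) := by
  refine Integrable.mono' (h.mem t ht)
    (by fun_prop : Continuous fun x : ℝ => 1 + x ^ 2).aestronglyMeasurable
    (Eventually.of_forall fun x => ?_)
  rw [Real.norm_of_nonneg (by positivity)]
  exact one_add_sq_le γ x

lemma integral_one_add_sq_le (h : IsMeasureWeakSolution a γ μ₀ ν) {t : ℝ} (ht : 0 ≤ t) :
    ∫ x, (1 + x ^ 2) ∂(ν t) ≤ wnorm (max γ 2) μ₀ :=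
  (integral_mono (h.integrable_one_add_sq ht) (h.mem t ht) (one_add_sq_le γ)).trans
    (h.norm_le t ht)

lemma integrable_id [IsProbabilityMeasure μ₀] (h : IsMeasureWeakSolution a γ μ₀ ν) {t : ℝ}
    (ht : 0 ≤ t) : Integrable (fun x : ℝ => x) (ν t) :=
  have := h.isProbabilityMeasure ht
  integrable_id_of_rpow (le_max_of_le_right (by norm_num)) (h.integrable_rpow ht)

lemma integrable_tail [IsProbabilityMeasure μ₀] (h : IsMeasureWeakSolution a γ μ₀ ν) {t : ℝ}
    (ht : 0 ≤ t) {r : ℝ} (hr : 0 ≤ r) : Integrable (tail r) (ν t) :=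
  (h.integrable_id ht).abs.mono' (continuous_tail r).aestronglyMeasurable
    (Eventually.of_forall fun x => by
      rw [Real.norm_of_nonneg (tail_nonneg r x)]; exact tail_le_abs hr x)

lemma continuousOn_integral (h : IsMeasureWeakSolution a γ μ₀ ν) (φ : ℝ →ᵇ ℝ) :
    ContinuousOn (fun t => ∫ x, φ x ∂(ν t)) (Ici 0) := by
  set q : ℝ → ℝ := fun τ => collisionQ a γ (ν (max τ 0)) (ν (max τ 0)) φ with hq
  have hqc : Continuous q := (h.continuousOn φ).comp_continuous
    (f := fun τ : ℝ => max τ 0) (by fun_prop) (fun τ => mem_Ici.2 (le_max_right _ _))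
  have hc : Continuous fun t => ∫ x, φ x ∂μ₀ + ∫ τ in (0 : ℝ)..t, q τ :=
    continuous_const.add
      (intervalIntegral.continuous_primitive (fun _ _ => hqc.intervalIntegrable _ _) 0)
  refine hc.continuousOn.congr fun t ht => ?_
  simp only
  rw [h.weak_eq φ t ht]
  congr 1
  refine intervalIntegral.integral_congr fun τ hτ => ?_
  rw [uIcc_of_le ht] at hτ
  simp only [hq, max_eq_left hτ.1]

lemma continuousOn_tail [IsProbabilityMeasure μ₀] (h : IsMeasureWeakSolution a γ μ₀ ν) {r : ℝ}
    (hr : 0 ≤ r) : ContinuousOn (fun t => ∫ x, tail r x ∂(ν t)) (Ici 0) := by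
  have hu : TendstoUniformlyOn (fun (n : ℕ) t => ∫ x, cutTail r n x ∂(ν t))
      (fun t => ∫ x, tail r x ∂(ν t)) atTop (Ici 0) := by
    rw [Metric.tendstoUniformlyOn_iff]
    intro ε hε
    have lim : Tendsto (fun n : ℕ => 1 / ((n : ℝ) + 1) * (2 * wnorm (max γ 2) μ₀)) atTop (𝓝 0) := by
      simpa using tendsto_one_div_add_atTop_nhds_zero_nat.mul_const (2 * wnorm (max γ 2) μ₀)
    filter_upwards [lim.eventually_lt_const hε] with n hn t ht
    have := h.isProbabilityMeasure ht
    rw [Real.dist_eq, ← integral_sub (h.integrable_tail ht hr) ((cutTail r n).integrable _),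
      ← Real.norm_eq_abs]
    refine (norm_integral_le_of_norm_le (((h.integrable_one_add_sq ht).const_mul 2).const_mul
      (1 / ((n : ℝ) + 1))) (Eventually.of_forall (tail_sub_cutTail_le hr n))).trans_lt ?_
    rw [integral_const_mul, integral_const_mul]
    refine lt_of_le_of_lt ?_ hn
    have := h.integral_one_add_sq_le ht
    gcongr
  exact hu.continuousOn (Frequently.of_forall fun n => h.continuousOn_integral _)

/-- While the moment of order `1 + γ` stays bounded, the functions `(|x| - r)₊` are admissible test
functions, and convexity shows that their integrals decrease. -/
lemma integral_tail_le_of_bounded [IsProbabilityMeasure μ₀] (ha₀ : 0 < a) (ha₁ : a < 1)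
    (hγ : 0 < γ) (h : IsMeasureWeakSolution a γ μ₀ ν) {r u t K : ℝ} (hr : 0 ≤ r) (hu : 0 ≤ u)
    (hut : u ≤ t) (hi : ∀ τ ∈ Icc u t, Integrable (fun x : ℝ => |x| ^ (1 + γ)) (ν τ))
    (hK : ∀ τ ∈ Icc u t, ∫ x, |x| ^ (1 + γ) ∂(ν τ) ≤ K) :
    ∫ x, tail r x ∂(ν t) ≤ ∫ x, tail r x ∂(ν u) := by
  set D : ℝ × ℝ → ℝ := fun p => 3 * (2 ^ (1 + γ) * (|p.1| ^ (1 + γ) + |p.2| ^ (1 + γ))) with hD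
  have hDi : ∀ τ ∈ Icc u t, Integrable D ((ν τ).prod (ν τ)) := fun τ hτ => by
    have := h.isProbabilityMeasure (hu.trans hτ.1)
    exact ((((hi τ hτ).comp_fst (ν τ)).add ((hi τ hτ).comp_snd (ν τ))).const_mul _).const_mul _
  have hDint : ∀ τ ∈ Icc u t, ∫ p, D p ∂((ν τ).prod (ν τ)) ≤ 3 * (2 ^ (1 + γ) * (K + K)) := by
    intro τ hτ
    have := h.isProbabilityMeasure (hu.trans hτ.1)
    have e1 : ∫ p : ℝ × ℝ, |p.1| ^ (1 + γ) ∂((ν τ).prod (ν τ)) = ∫ x, |x| ^ (1 + γ) ∂(ν τ) := by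
      rw [integral_fun_fst (fun x : ℝ => |x| ^ (1 + γ))]; simp
    have e2 : ∫ p : ℝ × ℝ, |p.2| ^ (1 + γ) ∂((ν τ).prod (ν τ)) = ∫ x, |x| ^ (1 + γ) ∂(ν τ) := by
      rw [integral_fun_snd (fun x : ℝ => |x| ^ (1 + γ))]; simp
    simp only [hD]
    rw [integral_const_mul, integral_const_mul,
      integral_add ((hi τ hτ).comp_fst (ν τ)) ((hi τ hτ).comp_snd (ν τ)), e1, e2]
    have := hK τ hτ
    gcongr
  have hbound : ∀ φ : ℝ → ℝ, (∀ x, |φ x| ≤ |x|) → ∀ p : ℝ × ℝ,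
      ‖|p.1 - p.2| ^ γ * collisionDelta a φ p.1 p.2‖ ≤ D p := by
    intro φ hφ p
    rw [Real.norm_eq_abs, abs_mul, abs_of_nonneg (kernel_nonneg γ p)]
    have h1 := mul_le_mul_of_nonneg_left (abs_collisionDelta_le_of_le_abs ha₀ ha₁ hφ p.1 p.2)
      (kernel_nonneg γ p)
    have h2 := kernel_mul_add_le p.1 p.2 hγ.le
    simp only [hD]
    linarith
  have hcut := fun n => hbound (cutTail r n) (abs_cutTail_le hr n)
  have hQlim : ∀ τ ∈ Icc u t, Tendsto (fun n => collisionQ a γ (ν τ) (ν τ) (cutTail r n)) atTop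
      (𝓝 (collisionQ a γ (ν τ) (ν τ) (tail r))) := by
    intro τ hτ
    refine (tendsto_integral_of_dominated_convergence D (fun n =>
      ((continuous_kernel hγ.le).mul
        (continuous_collisionDelta a (cutTail r n).continuous)).aestronglyMeasurable)
      (hDi τ hτ) (fun n => Eventually.of_forall (hcut n))
      (Eventually.of_forall fun p => ?_)).const_mul (1 / 2)
    exact ((((tendsto_cutTail r _).add (tendsto_cutTail r _)).sub (tendsto_cutTail r _)).sub
      (tendsto_cutTail r _)).const_mul _
  have hQneg : ∀ τ, collisionQ a γ (ν τ) (ν τ) (tail r) ≤ 0 := fun τ => by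
    refine mul_nonpos_of_nonneg_of_nonpos (by norm_num) (integral_nonpos fun p => ?_)
    exact mul_nonpos_of_nonneg_of_nonpos (kernel_nonneg γ p)
      (collisionDelta_nonpos ha₀ ha₁ (convexOn_tail r) _ _)
  have hlim1 : Tendsto (fun n => ∫ τ in u..t, collisionQ a γ (ν τ) (ν τ) (cutTail r n)) atTop
      (𝓝 (∫ τ in u..t, collisionQ a γ (ν τ) (ν τ) (tail r))) := by
    refine intervalIntegral.tendsto_integral_filter_of_dominated_convergence
      (fun _ => 1 / 2 * (3 * (2 ^ (1 + γ) * (K + K))))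
      (Eventually.of_forall fun n => ?_) (Eventually.of_forall fun n =>
        Eventually.of_forall fun τ hτ => ?_) intervalIntegrable_const
      (Eventually.of_forall fun τ hτ => ?_)
    · exact (h.intervalIntegrable (cutTail r n) hu hut).aestronglyMeasurable_restrict_uIoc
    · rw [uIoc_of_le hut] at hτ
      have hτ' : τ ∈ Icc u t := Ioc_subset_Icc_self hτ
      rw [collisionQ, norm_mul, Real.norm_of_nonneg (by norm_num : (0 : ℝ) ≤ 1 / 2)]
      refine mul_le_mul_of_nonneg_left ?_ (by norm_num)
      exact (norm_integral_le_of_norm_le (hDi τ hτ') (Eventually.of_forall (hcut n))).trans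
        (hDint τ hτ')
    · rw [uIoc_of_le hut] at hτ
      exact hQlim τ (Ioc_subset_Icc_self hτ)
  have hlim2 : ∀ τ, 0 ≤ τ → Tendsto (fun n => ∫ x, cutTail r n x ∂(ν τ)) atTop
      (𝓝 (∫ x, tail r x ∂(ν τ))) := fun τ hτ =>
    tendsto_integral_of_dominated_convergence (fun x => |x|)
      (fun n => (cutTail r n).continuous.aestronglyMeasurable) (h.integrable_id hτ).abs
      (fun n => Eventually.of_forall (abs_cutTail_le hr n))
      (Eventually.of_forall (tendsto_cutTail r))
  have heq : ∫ x, tail r x ∂(ν t) - ∫ x, tail r x ∂(ν u) =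
      ∫ τ in u..t, collisionQ a γ (ν τ) (ν τ) (tail r) :=
    tendsto_nhds_unique ((hlim2 t (hu.trans hut)).sub (hlim2 u hu))
      (hlim1.congr fun n => (h.integral_sub_eq _ hu hut).symm)
  have hneg : ∫ τ in u..t, collisionQ a γ (ν τ) (ν τ) (tail r) ≤ 0 := by
    rw [intervalIntegral.integral_of_le hut]
    exact integral_nonpos hQneg
  linarith

/-- A weak solution whose moment of order `1 + γ` is finite at all times decreases in the convex
order, even though nothing is assumed on the size of this moment as time varies. -/
theorem integral_tail_le [IsProbabilityMeasure μ₀] (ha₀ : 0 < a) (ha₁ : a < 1) (hγ : 0 < γ)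
    (h : IsMeasureWeakSolution a γ μ₀ ν)
    (hi : ∀ t, 0 ≤ t → Integrable (fun x : ℝ => |x| ^ (1 + γ)) (ν t)) {u t : ℝ} (hu : 0 ≤ u)
    (hut : u ≤ t) {r : ℝ} (hr : 0 ≤ r) : ∫ x, tail r x ∂(ν t) ≤ ∫ x, tail r x ∂(ν u) := by
  have hp0 : ∀ x : ℝ, 0 ≤ |x| ^ (1 + γ) := fun x => Real.rpow_nonneg (abs_nonneg x) _
  have hpc : Continuous fun x : ℝ => |x| ^ (1 + γ) := continuous_abs_rpow (by linarith)
  set M : ℝ → ℝ≥0∞ := fun t => ∫⁻ x, ENNReal.ofReal (|x| ^ (1 + γ)) ∂(ν t) with hMdef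
  let H : {r : ℝ // 0 ≤ r} → ℝ → ℝ := fun r t => ∫ x, tail r x ∂(ν t)
  refine antitone_of_locally_bounded (H := H) (M := M) (fun i => h.continuousOn_tail i.2)
    (fun t ht => ?_) (fun K => ?_) (fun u t hu hut hle => ?_) (fun K u t hu hut hK i => ?_) hu hut
    ⟨r, hr⟩
  · have := (hi t ht).2
    rw [hasFiniteIntegral_iff_ofReal (Eventually.of_forall hp0)] at this
    exact this.ne
  · -- lower semicontinuity: `M` is a supremum of integrals of bounded continuous functions
    let φ : ℕ → (ℝ →ᵇ ℝ) := fun n => BoundedContinuousFunction.ofNormedAddCommGroup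
      (fun x => min (|x| ^ (1 + γ)) n) (hpc.min continuous_const) n fun x => by
        rw [Real.norm_of_nonneg (le_min (hp0 x) n.cast_nonneg)]; exact min_le_right _ _
    have hset : {t : ℝ | 0 ≤ t ∧ M t ≤ K} = ⋂ n, (Ici 0 ∩
        (fun t => ∫ x, φ n x ∂(ν t)) ⁻¹' Iic (K : ℝ)) := by
      ext t
      simp only [mem_ofPred_eq, mem_iInter, mem_inter_iff, mem_Ici, mem_preimage, mem_Iic]
      have e : ∀ n, 0 ≤ t → (∫ x, φ n x ∂(ν t) ≤ K ↔
          ∫⁻ x, ENNReal.ofReal (min (|x| ^ (1 + γ)) n) ∂(ν t) ≤ K) := fun n ht => by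
        have := h.isProbabilityMeasure ht
        have := ofReal_integral_eq_lintegral_ofReal ((φ n).integrable (ν t))
          (Eventually.of_forall fun x => le_min (hp0 x) n.cast_nonneg)
        rw [← ENNReal.ofReal_le_ofReal_iff K.cast_nonneg, this, ENNReal.ofReal_natCast]
        rfl
      refine ⟨fun ⟨ht, hM⟩ n => ⟨ht, (e n ht).2 ?_⟩, fun hall => ?_⟩
      · exact (lintegral_mono fun x => ENNReal.ofReal_le_ofReal (min_le_left _ _)).trans hM
      · have ht := (hall 0).1
        refine ⟨ht, le_of_tendsto' (lintegral_tendsto_of_tendsto_of_monotone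
          (f := fun (n : ℕ) (x : ℝ) => ENNReal.ofReal (min (|x| ^ (1 + γ)) n))
          (fun n => (hpc.min continuous_const).measurable.ennreal_ofReal.aemeasurable)
          (Eventually.of_forall fun x n m hnm => ENNReal.ofReal_le_ofReal
            (min_le_min_left _ (by exact_mod_cast hnm)))
          (Eventually.of_forall fun x => ?_)) fun n => (e n ht).1 (hall n).2⟩
        refine tendsto_const_nhds.congr' ?_
        filter_upwards [eventually_ge_atTop ⌈|x| ^ (1 + γ)⌉₊] with n hn
        rw [min_eq_left ((Nat.le_ceil _).trans (by exact_mod_cast hn))]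
    rw [hset]
    exact isClosed_iInter fun n =>
      (h.continuousOn_integral (φ n)).preimage_isClosed_of_isClosed isClosed_Ici isClosed_Iic
  · have := h.isProbabilityMeasure hu
    have := h.isProbabilityMeasure (hu.trans hut)
    exact lintegral_rpow_le_of_tail_le (h.integrable_id (hu.trans hut)) (h.integrable_id hu)
      (fun r hr => hle ⟨r, hr⟩) (by linarith)
  · refine h.integral_tail_le_of_bounded (K := K) ha₀ ha₁ hγ i.2 hu hut
      (fun τ hτ => hi τ (hu.trans hτ.1)) fun τ hτ => ?_
    rw [← ENNReal.ofReal_le_ofReal_iff K.cast_nonneg, ENNReal.ofReal_natCast,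
      ofReal_integral_eq_lintegral_ofReal (hi τ (hu.trans hτ.1)) (Eventually.of_forall hp0)]
    exact hK τ hτ

end IsMeasureWeakSolution

/-- Moment comparison turns an exponential moment of `μ₀` into a bound for all measures with smaller
moments. -/
lemma integral_exp_le_of_moments_le {μ μ₀ : Measure ℝ} [IsProbabilityMeasure μ] {γ ε : ℝ}
    (hγ : 0 ≤ γ) (hε : 0 ≤ ε) (h₀ : Integrable (fun x => Real.exp (ε * |x| ^ γ)) μ₀)
    (h₁ : Integrable (fun x : ℝ => x) μ₀)
    (h : ∀ p : ℝ, 1 ≤ p →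
      ∫⁻ x, ENNReal.ofReal (|x| ^ p) ∂μ ≤ ∫⁻ x, ENNReal.ofReal (|x| ^ p) ∂μ₀) :
    Integrable (fun x => Real.exp (ε * |x| ^ γ)) μ ∧
      ∫ x, Real.exp (ε * |x| ^ γ) ∂μ ≤
        (∫⁻ x, ENNReal.ofReal (Real.exp (ε * |x| ^ γ)) ∂μ₀ +
          ENNReal.ofReal (Real.exp ε) * (1 + ∫⁻ x, ENNReal.ofReal |x| ∂μ₀)).toReal := by
  have key := lintegral_exp_le_of_moments_le hγ hε h
  have f1 : ∫⁻ x, ENNReal.ofReal (Real.exp (ε * |x| ^ γ)) ∂μ₀ ≠ ∞ :=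
    ((hasFiniteIntegral_iff_ofReal (Eventually.of_forall fun x => (Real.exp_pos _).le)).1 h₀.2).ne
  have f2 : ∫⁻ x, ENNReal.ofReal |x| ∂μ₀ ≠ ∞ :=
    ((hasFiniteIntegral_iff_ofReal (Eventually.of_forall fun x => abs_nonneg x)).1 h₁.abs.2).ne
  have hfin : ∫⁻ x, ENNReal.ofReal (Real.exp (ε * |x| ^ γ)) ∂μ₀ +
      ENNReal.ofReal (Real.exp ε) * (1 + ∫⁻ x, ENNReal.ofReal |x| ∂μ₀) ≠ ∞ := by finiteness
  have hc : Continuous fun x : ℝ => Real.exp (ε * |x| ^ γ) :=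
    Real.continuous_exp.comp (continuous_const.mul (continuous_abs_rpow hγ))
  have hi : Integrable (fun x => Real.exp (ε * |x| ^ γ)) μ := by
    refine ⟨hc.aestronglyMeasurable, ?_⟩
    rw [hasFiniteIntegral_iff_ofReal (Eventually.of_forall fun x => (Real.exp_pos _).le)]
    exact key.trans_lt hfin.lt_top
  refine ⟨hi, ?_⟩
  rw [integral_eq_lintegral_of_nonneg_ae (Eventually.of_forall fun x => (Real.exp_pos _).le)
    hc.aestronglyMeasurable]
  exact ENNReal.toReal_mono hfin key

end DissipativeBoltzmann

theorem mainTheorem3 (a γ : ℝ) (ha₀ : 0 < a) (ha₁ : a < 1) (hγ : 0 < γ)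
    (μ₀ : Measure ℝ) (hμ₀ : μ₀ ∈ DissipativeBoltzmann.PZero (max γ 2)) :
    ∃ μ : ℝ → Measure ℝ,
      DissipativeBoltzmann.IsMeasureWeakSolution a γ μ₀ μ ∧
      -- conservation of mass and momentum
      (∀ t, 0 ≤ t → μ t ∈ DissipativeBoltzmann.PZero (max γ 2) ∧
        (μ t univ = μ₀ univ ∧ μ₀ univ = 1) ∧
        (∫ x, x ∂(μ t) = ∫ x, x ∂μ₀ ∧ ∫ x, x ∂μ₀ = 0)) ∧
      -- the moment of order `max γ 2` is non-increasing
      (∀ s t, 0 ≤ s → s ≤ t →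
        DissipativeBoltzmann.moment (max γ 2) (μ t) ≤
          DissipativeBoltzmann.moment (max γ 2) (μ s)) ∧
      (∀ t, 0 ≤ t →
        DissipativeBoltzmann.moment (max γ 2) (μ t) ≤ DissipativeBoltzmann.moment (max γ 2) μ₀) ∧
      -- propagation of moments of all orders
      ((∀ k : ℝ, 0 ≤ k → μ₀ ∈ DissipativeBoltzmann.PZero k) →
        ∀ t, 0 ≤ t → ∀ k : ℝ, 0 ≤ k → μ t ∈ DissipativeBoltzmann.PZero k) ∧
      -- uniqueness for initial data with exponential tails
      ((∃ ε : ℝ, 0 < ε ∧ Integrable (fun x : ℝ => Real.exp (ε * |x| ^ γ)) μ₀) →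
        ∀ ν : ℝ → Measure ℝ, DissipativeBoltzmann.IsMeasureWeakSolution a γ μ₀ ν →
          (∀ t, 0 < t → Integrable (fun x : ℝ => |x| ^ (1 + γ)) (ν t)) →
          ∀ t, 0 ≤ t → ν t = μ t) ∧
      -- propagation of absolute continuity
      (μ₀ ≪ volume →
        ∃ f : ℝ → ℝ → ℝ, ∀ t, 0 ≤ t → μ t ≪ volume ∧
          (∀ x, 0 ≤ f t x) ∧ DissipativeBoltzmann.MemL1 (max γ 2) (f t) ∧
          μ t = volume.withDensity (fun x => ENNReal.ofReal (f t x))) := by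
  open DissipativeBoltzmann in
  obtain ⟨hprob, h₀, hid, hmean⟩ := hμ₀
  have hs : γ ≤ max γ 2 := le_max_left _ _
  have hs1 : 1 ≤ max γ 2 := le_max_of_le_right (by norm_num)
  obtain ⟨m, hm⟩ := exists_isCollisionFlow ha₀ ha₁ hγ hs hs1 h₀
  have hp := hm.prob
  have hsol := hm.isMeasureWeakSolution hγ h₀
  have hmom : ∀ t, ∫ x, x ∂(m t) = 0 := fun t => (hm.integral_id hs1 h₀ t).trans hmean
  have hint : ∀ t, Integrable (fun x : ℝ => x) (m t) := fun t =>
    integrable_id_of_rpow hs1 (hm.integrable_rpow hs1 h₀ t)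
  refine ⟨m, hsol, fun t _ => ⟨⟨hp t, hm.integrable_rpow hs1 h₀ t, hint t, hmom t⟩,
    ⟨by simp, measure_univ⟩, (hmom t).trans hmean.symm, hmean⟩,
    fun s t _ hst => hm.moment_antitone s t hst,
    fun t ht => (hm.moment_antitone 0 t ht).trans_eq (by rw [hm.zero]), ?_, ?_, ?_⟩
  · intro hall t _ k hk
    refine ⟨hp t, ?_, hint t, hmom t⟩
    exact integrable_abs_rpow_of_le hk (le_max_left k 1)
      (hm.integrable_rpow (le_max_right k 1) (hall _ (hk.trans (le_max_left k 1))).2.1 t)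
  · rintro ⟨ε, hε, hexp⟩ ν hν hνi t ht
    have hνi' : ∀ t, 0 ≤ t → Integrable (fun x : ℝ => |x| ^ (1 + γ)) (ν t) := fun t ht => by
      rcases ht.eq_or_lt with rfl | ht
      · rw [hν.zero_eq]
        exact integrable_rpow_of_exp hε hγ hexp (by linarith)
      · exact hνi t ht
    have boundμ := fun t (_ : 0 ≤ t) => integral_exp_le_of_moments_le hγ.le hε.le hexp hid
      fun p hp => hm.convexLE t _ (convexOn_abs_rpow hp)
        (fun x => Real.rpow_nonneg (abs_nonneg x) p) (continuous_abs_rpow (by linarith))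
    have boundν := fun t (ht : 0 ≤ t) =>
      have := hν.isProbabilityMeasure ht
      integral_exp_le_of_moments_le hγ.le hε.le hexp hid fun p hp =>
        lintegral_rpow_le_of_tail_le (hν.integrable_id ht) hid (fun r hr => by
          have := hν.integral_tail_le ha₀ ha₁ hγ hνi' le_rfl ht hr
          rwa [hν.zero_eq] at this) hp
    exact hsol.eq_of_exp_moment hγ hν hε (fun t ht => (boundμ t ht).1) (fun t ht => (boundν t ht).1)
      (fun t ht => (boundμ t ht).2) (fun t ht => (boundν t ht).2) ht
  · intro hac
    have hact : ∀ t, 0 ≤ t → m t ≪ volume := fun t ht =>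
      hm.absolutelyContinuous ha₀.ne' hγ hs hs1 h₀ hac ht
    have hdens : ∀ t, ∃ f : ℝ → ℝ, 0 ≤ t → (∀ x, 0 ≤ f x) ∧ MemL1 (max γ 2) f ∧
        m t = volume.withDensity fun x => ENNReal.ofReal (f x) := fun t => by
      by_cases ht : 0 ≤ t
      · obtain ⟨f, hf⟩ := hm.exists_density hs1 h₀ (hact t ht)
        exact ⟨f, fun _ => hf⟩
      · exact ⟨0, fun h => absurd h ht⟩
    choose f hf using hdens
    exact ⟨f, fun t ht => ⟨hact t ht, hf t ht⟩⟩
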